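/- Let $X$ be a proper CAT(0) space, let $G\le \mathrm{Is}(X)$ be any group of isometries of $X$, and let $\rho:\mathbf R\to X$ be a geodesic map (that is, an isometric embedding). Suppose that there is an increasing sequence $(t_n)_{n\ge 0}$ of positive real numbers tending to infinity such that $\sup_n d(\rho(t_n),\rho(t_{n+1}))<\infty$ and such that the set $\{\rho(t_n)\mid n\ge 0\}$ falls into finitely many $G$-orbits, each of which is discrete. Then there is a strictly increasing sequence $(f(n))_{n\ge 0}$ of positive integers such that, for all $n>m\geq 0$, there is a hyperbolic isometry $h_{m,n}\in G$ that has a translation axis containing the geodesic segment $[\rho(t_{f(m)}),\rho(t_{f(n)})]$. If in addition $X$ is a locally finite Euclidean building, $G$ acts on $X$ by automorphisms of the building (possibly not type-preserving), and the geodesic line $\rho$ is strongly regular, then $(f(n))_n$ and the elements $h_{m,n}$ can be chosen such that, moreover, every $h_{m,n}$ is a strongly regular hyperbolic automorphism. Here an isometry $\gamma$ is hyperbolic if its displacement function $x\mapsto d(x,\gamma x)$ attains a minimum $|\gamma|>0$; $\mathrm{Min}(\gamma)$ is the set of points where it is attained, and a translation axis of $\gamma$ is a geodesic line along which $\gamma$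 translates by $|\gamma|$. The hyperbolic isometry $\gamma$ is regular hyperbolic if $\mathrm{Min}(\gamma)$ is at bounded Hausdorff distance from a maximal flat. A Euclidean building is a building whose apartments are Euclidean spaces tessellated by a discrete cocompact affine reflection group; it is considered with its complete system of apartments, its CAT(0) metric and its cell structure, and an automorphism is an isometry that preserves the set of chambers. An automorphism $\gamma$ is strongly regular hyperbolic if it is regular hyperbolic, $\mathrm{Min}(\gamma)$ contains a unique apartment, and the translation axes of $\gamma$ cross all walls of this apartment. A geodesic line is strongly regular if its two endpoints in the visual boundary lie in the interiors of two opposite chambers of the spherical building at infinity. -/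

import Mathlib

open Set Filter Metric
open scoped NNReal Topology

noncomputable section

/-! ### CAT(0) spaces and their isometries -/

/-- Every two points are joined by a geodesic segment. -/
def IsGeodesicSpace (X : Type*) [MetricSpace X] : Prop :=
  ∀ p q : X, ∃ γ : ℝ → X, γ 0 = p ∧ γ (dist p q) = q ∧
    ∀ s ∈ Icc (0 : ℝ) (dist p q), ∀ t ∈ Icc (0 : ℝ) (dist p q), dist (γ s) (γ t) = |s - t|

/-- A geodesic space in which geodesic triangles are at least as thin as their comparison
triangles in the Euclidean plane. Here `x` is a point of a side from `p` to `q`, `y` a point of a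
side from `p` to `r` (in a geodesic space the points of geodesic segments from `p` to `q` are
exactly the `x` with `dist p x + dist x q = dist p q`), `p' q' r'` is a comparison triangle and
`x' y'` are the comparison points. -/
structure IsCAT0 (X : Type*) [MetricSpace X] : Prop where
  geodesic : IsGeodesicSpace X
  comparison : ∀ p q r x y : X,
    dist p x + dist x q = dist p q → dist p y + dist y r = dist p r →
    ∀ p' q' r' x' y' : EuclideanSpace ℝ (Fin 2),
      dist p' q' = dist p q → dist p' r' = dist p r → dist q' r' = dist q r →
      dist p' x' = dist p x → dist x' q' = dist x q →
      dist p' y' = dist p y → dist y' r' = dist y r →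
      dist x y ≤ dist x' y'

section Isometries

variable {X : Type*} [MetricSpace X]

/-- The translation length `|γ|`. -/
def translationLength (γ : X ≃ᵢ X) : ℝ := ⨅ x : X, dist x (γ x)

/-- `Min(γ)`, the set where the displacement of `γ` equals `|γ|`. -/
def minSet (γ : X ≃ᵢ X) : Set X := {x | dist x (γ x) = translationLength γ}

/-- `γ` is hyperbolic: its displacement function attains a positive minimum. -/
def IsHyperbolic (γ : X ≃ᵢ X) : Prop := 0 < translationLength γ ∧ (minSet γ).Nonempty

/-- `L` is (the image of) a geodesic line along which `γ` translates by `|γ|`. -/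
def IsTranslationAxis (γ : X ≃ᵢ X) (L : Set X) : Prop :=
  ∃ c : ℝ → X, Isometry c ∧ range c = L ∧ ∀ s, γ (c s) = c (s + translationLength γ)

/-- A flat: an isometrically embedded Euclidean space. -/
def IsFlat (F : Set X) : Prop :=
  ∃ (n : ℕ) (φ : EuclideanSpace ℝ (Fin n) → X), Isometry φ ∧ range φ = F

/-- A flat that is contained in no larger flat. -/
def IsMaximalFlat (F : Set X) : Prop := Maximal IsFlat F

/-- Regular hyperbolic isometry: `Min(γ)` is at bounded Hausdorff distance from a maximal flat. -/
def IsRegularHyperbolic (γ : X ≃ᵢ X) : Prop :=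
  IsHyperbolic γ ∧ ∃ F : Set X, IsMaximalFlat F ∧ hausdorffEDist (minSet γ) F < ⊤

/-- The orbit of `x` under a group of isometries. -/
def isometryOrbit (G : Subgroup (X ≃ᵢ X)) (x : X) : Set X := {y | ∃ g ∈ G, g x = y}

end Isometries

/-! ### The visual boundary -/

/-- Geodesic rays `[0, ∞) → X`. -/
def GeodesicRay (X : Type*) [MetricSpace X] : Type _ := {r : ℝ≥0 → X // Isometry r}

/-- Two rays are asymptotic if they stay at bounded distance from each other. -/
def asymptoticSetoid (X : Type*) [MetricSpace X] : Setoid (GeodesicRay X) where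
  r r₁ r₂ := ∃ K : ℝ, ∀ s : ℝ≥0, dist (r₁.1 s) (r₂.1 s) ≤ K
  iseqv :=
    { refl := fun r => ⟨0, fun s => by simp⟩
      symm := fun ⟨K, hK⟩ => ⟨K, fun s => by rw [dist_comm]; exact hK s⟩
      trans := fun ⟨K, hK⟩ ⟨K', hK'⟩ =>
        ⟨K + K', fun s => (dist_triangle _ _ _).trans (add_le_add (hK s) (hK' s))⟩ }

/-- The visual boundary `∂X` (as a set). -/
def VisualBoundary (X : Type*) [MetricSpace X] : Type _ := Quotient (asymptoticSetoid X)

section Lines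

variable {X : Type*} [MetricSpace X]

/-- The endpoint in `∂X` of a geodesic ray. -/
def GeodesicRay.endpoint (r : GeodesicRay X) : VisualBoundary X :=
  Quotient.mk (asymptoticSetoid X) r

/-- The ray `s ↦ ρ s`. -/
def forwardRay (ρ : ℝ → X) (hρ : Isometry ρ) : GeodesicRay X :=
  ⟨fun s => ρ s, Isometry.of_dist_eq fun a b => hρ.dist_eq (a : ℝ) (b : ℝ)⟩

/-- The ray `s ↦ ρ (-s)`. -/
def backwardRay (ρ : ℝ → X) (hρ : Isometry ρ) : GeodesicRay X :=
  ⟨fun s => ρ (-(s : ℝ)), Isometry.of_dist_eq fun a b => by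
    rw [hρ.dist_eq, dist_neg_neg]; rfl⟩

end Lines

/-! ### Affine reflection groups -/

section ReflectionGroups

variable {d : ℕ}

/-- The hyperplane with normal vector `v` and offset `c`. -/
def hyperplane (v : EuclideanSpace ℝ (Fin d)) (c : ℝ) : Set (EuclideanSpace ℝ (Fin d)) :=
  {x | inner ℝ v x = c}

/-- `g` is the orthogonal reflection in the hyperplane with unit normal vector `v` and offset
`c`. -/
def IsReflectionIn (g : EuclideanSpace ℝ (Fin d) ≃ᵃⁱ[ℝ] EuclideanSpace ℝ (Fin d))
    (v : EuclideanSpace ℝ (Fin d)) (c : ℝ) : Prop :=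
  ‖v‖ = 1 ∧ ∀ x, g x = x - (2 * (inner ℝ v x - c)) • v

variable (W : Subgroup (EuclideanSpace ℝ (Fin d) ≃ᵃⁱ[ℝ] EuclideanSpace ℝ (Fin d)))

/-- The hyperplane with unit normal vector `v` and offset `c` is a wall, that is, the reflection
in it belongs to `W`. -/
def IsWall (v : EuclideanSpace ℝ (Fin d)) (c : ℝ) : Prop := ∃ g ∈ W, IsReflectionIn g v c

/-- A Euclidean reflection group: generated by affine reflections, with a locally finite family of
walls, and acting cocompactly (equivalently, its chambers are compact). -/
structure IsEuclideanReflectionGroup : Prop where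
  generated : Subgroup.closure {g | g ∈ W ∧ ∃ v c, IsReflectionIn g v c} = W
  locallyFinite : ∀ (x : EuclideanSpace ℝ (Fin d)) (r : ℝ),
    {H | ∃ v c, IsWall W v c ∧ H = hyperplane v c ∧ (H ∩ closedBall x r).Nonempty}.Finite
  cocompact : ∃ R : ℝ, ∀ x y : EuclideanSpace ℝ (Fin d), ∃ w ∈ W, dist (w x) y ≤ R

/-- The closed cell carried by `x`, i.e. the intersection of all closed half-spaces bounded by
walls and containing `x`. (Replacing `(v, c)` by `(-v, -c)` yields the other side of a wall.) -/
def closedCell (x : EuclideanSpace ℝ (Fin d)) : Set (EuclideanSpace ℝ (Fin d)) :=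
  {y | ∀ v c, IsWall W v c → inner ℝ v x ≤ c → inner ℝ v y ≤ c}

/-- `x` lies on no wall, so that `closedCell W x` is a closed chamber. -/
def IsRegularPoint (x : EuclideanSpace ℝ (Fin d)) : Prop :=
  ∀ v c, IsWall W v c → inner ℝ v x ≠ c

/-- The direction `u` is parallel to no wall. -/
def IsRegularDirection (u : EuclideanSpace ℝ (Fin d)) : Prop :=
  ∀ v c, IsWall W v c → inner ℝ v u ≠ 0

/-- The open Weyl chamber (open cone of directions) containing the regular direction `u`. -/
def weylChamber (u : EuclideanSpace ℝ (Fin d)) : Set (EuclideanSpace ℝ (Fin d)) :=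
  {u' | ∀ v c, IsWall W v c → 0 < inner ℝ v u → 0 < inner ℝ v u'}

end ReflectionGroups

/-! ### Euclidean buildings -/

section Buildings

variable {X : Type*} [MetricSpace X] {d : ℕ}

/-- A system of apartments on `X` modelled on `W`, given by charts `E → X`: a subset of `X` is an
apartment if it is the image of a chart. -/
structure IsApartmentSystem
    (W : Subgroup (EuclideanSpace ℝ (Fin d) ≃ᵃⁱ[ℝ] EuclideanSpace ℝ (Fin d)))
    (charts : Set (EuclideanSpace ℝ (Fin d) → X)) : Prop where
  isometry : ∀ φ ∈ charts, Isometry φ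
  comp_mem : ∀ φ ∈ charts, ∀ w ∈ W, (fun x => φ (w x)) ∈ charts
  /-- The intersection of two apartments is a subcomplex of each of them. -/
  subcomplex : ∀ φ ∈ charts, ∀ ψ ∈ charts, ∀ x, φ x ∈ range ψ → φ '' closedCell W x ⊆ range ψ
  /-- Any two points (hence any two cells) lie in a common apartment. -/
  exists_common : ∀ x y : X, ∃ φ ∈ charts, x ∈ range φ ∧ y ∈ range φ
  /-- Any two apartments are related by a (type-preserving) isomorphism that fixes their
  intersection pointwise. -/
  exists_iso : ∀ φ ∈ charts, ∀ ψ ∈ charts, ∃ w ∈ W, ∀ x, φ x ∈ range ψ → φ x = ψ (w x)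

/-- The structure of a Euclidean building on the metric space `X`, with its complete
(that is, maximal) system of apartments. -/
structure EuclideanBuilding (X : Type*) [MetricSpace X] where
  /-- the dimension -/
  dim : ℕ
  /-- the Weyl group, acting on the model apartment -/
  W : Subgroup (EuclideanSpace ℝ (Fin dim) ≃ᵃⁱ[ℝ] EuclideanSpace ℝ (Fin dim))
  reflectionGroup : IsEuclideanReflectionGroup W
  /-- the charts of the apartments -/
  charts : Set (EuclideanSpace ℝ (Fin dim) → X)
  complete : Maximal (IsApartmentSystem W) charts

namespace EuclideanBuilding

variable (Δ : EuclideanBuilding X)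

/-- Apartments of `Δ`. -/
def IsApartment (A : Set X) : Prop := ∃ φ ∈ Δ.charts, range φ = A

/-- Closed chambers of `Δ`. -/
def IsChamber (C : Set X) : Prop :=
  ∃ φ ∈ Δ.charts, ∃ x, IsRegularPoint Δ.W x ∧ C = φ '' closedCell Δ.W x

/-- Every point lies in only finitely many chambers. -/
def IsLocallyFinite : Prop := ∀ x : X, {C : Set X | Δ.IsChamber C ∧ x ∈ C}.Finite

/-- `g` is an automorphism of `Δ`: an isometry that preserves the set of chambers (and hence the
set of cells, but not necessarily their types). -/
def IsAutomorphism (g : X ≃ᵢ X) : Prop := ∀ C : Set X, Δ.IsChamber (g '' C) ↔ Δ.IsChamber C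

/-- The interior of a chamber of the spherical building at infinity: the set of endpoints of the
rays which, in the chart `φ`, point into the open Weyl chamber of the direction `u`. -/
def idealChamberInterior (φ : EuclideanSpace ℝ (Fin Δ.dim) → X)
    (u : EuclideanSpace ℝ (Fin Δ.dim)) : Set (VisualBoundary X) :=
  {ξ | ∃ (r : GeodesicRay X) (x u' : EuclideanSpace ℝ (Fin Δ.dim)),
    ‖u'‖ = 1 ∧ u' ∈ weylChamber Δ.W u ∧ (∀ s : ℝ≥0, r.1 s = φ (x + (s : ℝ) • u')) ∧
    r.endpoint = ξ}

/-- `c` and `c'` are the interiors of two opposite chambers of the spherical building at infinity: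
they are opposite in the boundary of some apartment. -/
def AreOppositeIdealChamberInteriors (c c' : Set (VisualBoundary X)) : Prop :=
  ∃ φ ∈ Δ.charts, ∃ u, IsRegularDirection Δ.W u ∧
    c = Δ.idealChamberInterior φ u ∧ c' = Δ.idealChamberInterior φ (-u)

/-- The geodesic line `ρ` is strongly regular: its endpoints lie in the interiors of two opposite
chambers of the spherical building at infinity. -/
def IsStronglyRegularLine (ρ : ℝ → X) (hρ : Isometry ρ) : Prop :=
  ∃ c c' : Set (VisualBoundary X), Δ.AreOppositeIdealChamberInteriors c c' ∧
    (forwardRay ρ hρ).endpoint ∈ c ∧ (backwardRay ρ hρ).endpoint ∈ c'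

/-- `L` crosses every wall of the apartment `A`: for every wall it contains points of `A` lying
strictly on either side. -/
def CrossesAllWalls (L A : Set X) : Prop :=
  ∀ φ ∈ Δ.charts, range φ = A → ∀ v c, IsWall Δ.W v c →
    (∃ x, φ x ∈ L ∧ inner ℝ v x < c) ∧ ∃ x, φ x ∈ L ∧ c < inner ℝ v x

/-- `γ` is a strongly regular hyperbolic automorphism: it is a regular hyperbolic automorphism,
`Min(γ)` contains a unique apartment, and the translation axes of `γ` cross all its walls. -/
def IsStronglyRegularHyperbolic (γ : X ≃ᵢ X) : Prop :=
  Δ.IsAutomorphism γ ∧ IsRegularHyperbolic γ ∧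
    ∃ A : Set X, Δ.IsApartment A ∧ A ⊆ minSet γ ∧
      (∀ A', Δ.IsApartment A' → A' ⊆ minSet γ → A' = A) ∧
      (∃ L, IsTranslationAxis γ L) ∧
      ∀ L, IsTranslationAxis γ L → Δ.CrossesAllWalls L A

end EuclideanBuilding

end Buildings

end

open Set Filter Metric
open scoped NNReal Topology

/-! ### Comparison inequalities in CAT(0) spaces. -/

section CAT0

variable {X : Type*} [MetricSpace X]

/-! The first half is recurrence plus the local-to-global principle for geodesics. Move every `ρ (t
n)` by some `g n ∈ G` to a representative of its orbit. Infinitely many `n` share one orbit, and for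
these the images of `ρ (t (n + 1))` lie in a fixed ball and in finitely many discrete orbits, hence
in a finite set. So for infinitely many `n` the pair `(ρ (t n), ρ (t (n + 1)))` is carried to one
and the same pair (`exists_recurrent_subsequence`), and `(g n)⁻¹ * g m` carries an initial piece of
`ρ` at time `t m` onto one at time `t n`. The translates of `[ρ (t m), ρ (t n)]` under this isometry
then fit together without corners. In a CAT(0) space such a broken path is a geodesic, which is the
required axis (`IsCAT0.exists_line`, `IsCAT0.exists_line_of_shift`).

For buildings the key is rigidity: a line parallel to a regular line of an apartment lies in that
apartment (`IsCAT0.mem_range_of_parallel`). Hence a strongly regular `ρ` lies in an apartment. The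
axis, which shares a segment with `ρ`, lies in a possibly different apartment, obtained as a limit
of apartments containing longer and longer pieces (`IsCAT0.exists_chart_of_line`); completeness of
the apartment system enters here. By rigidity the isometry preserves this apartment. Its linear part
permutes the wall normals, which are finite in number and span, so some power is a translation
(`IsCAT0.exists_pow_translation`). That power keeps the axis, and rigidity again shows that its
minimal set is exactly the apartment (`IsCAT0.isStronglyRegularHyperbolic_of_translation`). -/

lemma exists_comparison_triangle {a b c : ℝ} (ha : 0 ≤ a) (hb : 0 ≤ b) (hc : 0 ≤ c)
    (h₁ : a ≤ b + c) (h₂ : b ≤ a + c) (h₃ : c ≤ a + b) :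
    ∃ p q r : EuclideanSpace ℝ (Fin 2), dist p q = a ∧ dist p r = b ∧ dist q r = c := by
  rcases ha.eq_or_lt with rfl | ha
  · have hbc : b = c := by linarith
    subst hbc
    refine ⟨!₂[0, 0], !₂[0, 0], !₂[b, 0], ?_, ?_, ?_⟩ <;>
      simp [EuclideanSpace.dist_eq, Fin.sum_univ_two, Real.dist_eq, Real.sqrt_sq_eq_abs, abs_of_nonneg hb]
  · set x := (a ^ 2 + b ^ 2 - c ^ 2) / (2 * a) with hx
    have hxa : 2 * a * x = a ^ 2 + b ^ 2 - c ^ 2 := by rw [hx]; field_simp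
    have hy : 0 ≤ b ^ 2 - x ^ 2 := by
      -- Heron's formula: this is sixteen times the squared area, and the four factors are
      -- nonnegative by the triangle inequalities.
      have h4 : 0 ≤ 4 * a ^ 2 * (b ^ 2 - x ^ 2) := by
        have : 4 * a ^ 2 * (b ^ 2 - x ^ 2)
            = ((a + b + c) * (a + b - c)) * ((c + a - b) * (c + b - a)) := by
          linear_combination (-(2 * a * x) - (a ^ 2 + b ^ 2 - c ^ 2)) * hxa
        rw [this]
        apply mul_nonneg <;> apply mul_nonneg <;> linarith
      by_contra hneg
      nlinarith [sq_pos_of_pos ha]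
    have hs := Real.sq_sqrt hy
    refine ⟨!₂[0, 0], !₂[a, 0], !₂[x, √(b ^ 2 - x ^ 2)], ?_, ?_, ?_⟩
    · simp [EuclideanSpace.dist_eq, Fin.sum_univ_two, Real.dist_eq, Real.sqrt_sq_eq_abs,
        abs_of_pos ha]
    · rw [EuclideanSpace.dist_eq, Real.sqrt_eq_iff_mul_self_eq (by positivity) hb]
      simp [Fin.sum_univ_two, Real.dist_eq, hs]
      ring
    · rw [EuclideanSpace.dist_eq, Real.sqrt_eq_iff_mul_self_eq (by positivity) hc]
      simp [Fin.sum_univ_two, Real.dist_eq, hs]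
      linear_combination -hxa

/-- `m` divides a geodesic segment from `q` to `r` in the ratio `l : 1 - l`. -/
def IsPointAt (q r : X) (l : ℝ) (m : X) : Prop :=
  0 ≤ l ∧ l ≤ 1 ∧ dist q m = l * dist q r ∧ dist m r = (1 - l) * dist q r

lemma IsPointAt.symm {q r m : X} {l : ℝ} (h : IsPointAt q r l m) : IsPointAt r q (1 - l) m :=
  ⟨by linarith [h.2.1], by linarith [h.1], by rw [dist_comm, h.2.2.2, dist_comm q],
    by rw [dist_comm, h.2.2.1, dist_comm q]; ring⟩

lemma isPointAt_div {q r m : X} {s : ℝ} (h : 0 < dist q r) (h₁ : dist q m = s)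
    (h₂ : dist m r = dist q r - s) : IsPointAt q r (s / dist q r) m := by
  have hs : 0 ≤ s := h₁ ▸ dist_nonneg
  have hs' : s ≤ dist q r := by linarith [dist_nonneg (x := m) (y := r)]
  refine ⟨by positivity, (div_le_one h).2 hs', ?_, ?_⟩
  · rw [h₁]; field_simp
  · rw [h₂]; field_simp

/-- The distance to a point of a segment is at most the Euclidean one. -/
lemma IsCAT0.sq_dist_le (hX : IsCAT0 X) (p : X) {q r m : X} {l : ℝ} (hm : IsPointAt q r l m) :
    dist p m ^ 2 ≤ (1 - l) * dist p q ^ 2 + l * dist p r ^ 2 - l * (1 - l) * dist q r ^ 2 := by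
  obtain ⟨hl, hl', h₁, h₂⟩ := hm
  obtain ⟨q', p', r', hqp, hqr, hpr⟩ := exists_comparison_triangle
    (dist_nonneg (x := q) (y := p)) (dist_nonneg (x := q) (y := r)) (dist_nonneg (x := p) (y := r))
    (by linarith [dist_triangle q r p, dist_comm r p]) (by linarith [dist_triangle q p r])
    (by linarith [dist_triangle p q r, dist_comm p q])
  set m' := AffineMap.lineMap q' r' l with hm'
  have hq : dist q' m' = dist q m := by
    rw [hm', dist_left_lineMap, h₁, hqr, Real.norm_of_nonneg hl]
  have hr : dist m' r' = dist m r := by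
    rw [hm', dist_lineMap_right, h₂, hqr, Real.norm_of_nonneg (by linarith)]
  have key := hX.comparison q p r p m (by simp) (by rw [h₁, h₂]; ring) q' p' r' p' m' hqp hqr hpr
    hqp (by simp) hq hr
  have hsq : dist p m ^ 2 ≤ dist p' m' ^ 2 := by gcongr
  refine hsq.trans (le_of_eq ?_)
  rw [← hqr, ← hpr, dist_comm p q, ← hqp, dist_comm q' p']
  simp only [dist_eq_norm]
  have e1 : p' - m' = (1 - l) • (p' - q') + l • (p' - r') := by
    rw [hm', AffineMap.lineMap_apply_module]; module
  have e2 : q' - r' = (p' - r') - (p' - q') := by abel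
  rw [e1, e2]
  generalize p' - q' = A
  generalize p' - r' = B
  rw [@norm_add_sq_real, @norm_sub_sq_real, norm_smul, norm_smul, real_inner_smul_left,
    real_inner_smul_right, mul_pow, mul_pow, Real.norm_eq_abs, Real.norm_eq_abs, sq_abs, sq_abs,
    real_inner_comm B]
  ring

/-- With the second point as vertex, the right-hand side of `IsCAT0.sq_dist_le` vanishes. -/
lemma IsCAT0.eq_of_isPointAt (hX : IsCAT0 X) {q r m n : X} {l : ℝ} (hm : IsPointAt q r l m)
    (hn : IsPointAt q r l n) : m = n := by
  have h := hX.sq_dist_le n hm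
  rw [dist_comm n q, hn.2.2.1, hn.2.2.2] at h
  have : dist n m ^ 2 ≤ 0 := h.trans (le_of_eq (by ring))
  have h0 : dist n m = 0 := by
    have := le_antisymm this (sq_nonneg _)
    simpa using this
  exact (dist_eq_zero.1 h0).symm

lemma IsCAT0.exists_isPointAt (hX : IsCAT0 X) (q r : X) {l : ℝ} (h : 0 ≤ l) (h' : l ≤ 1) :
    ∃ m, IsPointAt q r l m := by
  obtain ⟨γ, h0, h1, hγ⟩ := hX.geodesic q r
  have hd := dist_nonneg (x := q) (y := r)
  have hm : l * dist q r ∈ Icc 0 (dist q r) := ⟨by positivity, by nlinarith⟩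
  have e1 := hγ 0 ⟨le_rfl, hd⟩ _ hm
  have e2 := hγ _ hm (dist q r) ⟨hd, le_rfl⟩
  rw [h0] at e1
  rw [h1] at e2
  refine ⟨γ (l * dist q r), h, h', ?_, ?_⟩
  · rw [e1, zero_sub, abs_neg, abs_of_nonneg hm.1]
  · rw [e2, abs_sub_comm, abs_of_nonneg (by linarith [hm.2])]; ring

lemma IsCAT0.dist_le_mul (hX : IsCAT0 X) {p q r x y : X} {l : ℝ} (hx : IsPointAt p q l x)
    (hy : IsPointAt p r l y) : dist x y ≤ l * dist q r := by
  have h1 := hX.sq_dist_le x hy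
  have h2 := hX.sq_dist_le r hx
  rw [dist_comm x p, hx.2.2.1] at h1
  rw [dist_comm r x, dist_comm r p, dist_comm r q] at h2
  have hl := hx.1
  apply abs_le_of_sq_le_sq' _ (by positivity) |>.2
  nlinarith [mul_le_mul_of_nonneg_left h2 hl]

/-- Convexity of the distance between two segments. -/
lemma IsCAT0.dist_le_convex (hX : IsCAT0 X) {p q p' q' x y : X} {l : ℝ} (hx : IsPointAt p q l x)
    (hy : IsPointAt p' q' l y) : dist x y ≤ (1 - l) * dist p p' + l * dist q q' := by
  obtain ⟨z, hz⟩ := hX.exists_isPointAt p q' hx.1 hx.2.1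
  have h1 := hX.dist_le_mul hx hz
  have h2 := hX.dist_le_mul hz.symm hy.symm
  linarith [dist_triangle x z y]

/-- Comparison angles at `p` grow with the triangle. The angle is already `π` at scale `s`, so it is
`π` for the whole triangle; two uses of `IsCAT0.sq_dist_le` make this quantitative. -/
lemma IsCAT0.dist_eq_add_of_opposite (hX : IsCAT0 X) {p q r x y : X} {s : ℝ} (hs : 0 < s)
    (hpx : dist p x = s) (hxq : dist p x + dist x q = dist p q)
    (hpy : dist p y = s) (hyr : dist p y + dist y r = dist p r) (hxy : dist x y = 2 * s) :
    dist q r = dist q p + dist p r := by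
  have hA : 0 < dist p q := by linarith [dist_nonneg (x := x) (y := q)]
  have hB : 0 < dist p r := by linarith [dist_nonneg (x := y) (y := r)]
  have h1 := hX.sq_dist_le x (isPointAt_div hB hpy (by linarith))
  have h2 := hX.sq_dist_le r (isPointAt_div hA hpx (by linarith))
  rw [dist_comm r x, dist_comm r p, dist_comm r q] at h2
  rw [dist_comm x p, hpx, hxy] at h1
  refine le_antisymm (dist_triangle _ _ _) ?_
  rw [dist_comm q p]
  set A := dist p q
  set B := dist p r
  have h3 := h1.trans (sub_le_sub_right (add_le_add_right (mul_le_mul_of_nonneg_left h2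
    (by positivity : 0 ≤ s / B)) _) _)
  have h4 : 4 * s ^ 2 * (A * B) ≤ s ^ 2 * (dist q r ^ 2 - A ^ 2 - B ^ 2 + 2 * (A * B)) := by
    have := mul_le_mul_of_nonneg_right h3 (by positivity : 0 ≤ A * B)
    refine (le_of_eq (by ring)).trans (this.trans (le_of_eq ?_))
    field_simp
    ring
  have h5 : (A + B) ^ 2 ≤ dist q r ^ 2 := by
    have hs2 : 0 < s ^ 2 := by positivity
    have := le_of_mul_le_mul_left ((by ring : s ^ 2 * (4 * (A * B)) = _).trans_le h4) hs2
    nlinarith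
  exact abs_le_of_sq_le_sq' h5 dist_nonneg |>.2

/-- Compare `b` and `d` with the midpoint `m` of the diagonal `a c`, and use `(bm + dm)² ≤ 2 (bm² +
dm²)`. -/
lemma IsCAT0.quadrilateral (hX : IsCAT0 X) (a b c d : X) :
    dist a c ^ 2 + dist b d ^ 2 ≤ dist a b ^ 2 + dist b c ^ 2 + dist c d ^ 2 + dist d a ^ 2 := by
  obtain ⟨m, hm⟩ := hX.exists_isPointAt a c (l := 1 / 2) (by norm_num) (by norm_num)
  have h1 := hX.sq_dist_le b hm
  have h2 := hX.sq_dist_le d hm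
  have h3 := dist_triangle b m d
  rw [dist_comm m d] at h3
  rw [dist_comm b a] at h1
  rw [dist_comm d c] at h2
  nlinarith [sq_nonneg (dist b m - dist d m), dist_nonneg (x := b) (y := d)]

/-! ### Geodesic lines and parallelism. -/

lemma Isometry.isPointAt {c : ℝ → X} (hc : Isometry c) {a b : ℝ} (hab : a ≤ b) {l : ℝ}
    (h : 0 ≤ l) (h' : l ≤ 1) : IsPointAt (c a) (c b) l (c (a + l * (b - a))) := by
  have h0 : 0 ≤ l * (b - a) := mul_nonneg h (by linarith)
  have h1 : 0 ≤ (1 - l) * (b - a) := mul_nonneg (by linarith) (by linarith)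
  refine ⟨h, h', ?_, ?_⟩ <;> simp only [hc.dist_eq, Real.dist_eq]
  · rw [abs_sub_comm, abs_sub_comm a, abs_of_nonneg (by linarith), abs_of_nonneg (by linarith)]
    ring
  · rw [abs_sub_comm, abs_sub_comm a, abs_of_nonneg (by linarith), abs_of_nonneg (by linarith)]
    ring

lemma Isometry.comp_add_right {c : ℝ → X} (hc : Isometry c) (a : ℝ) :
    Isometry fun s => c (s + a) :=
  Isometry.of_dist_eq fun x y => by simp [hc.dist_eq]

lemma Isometry.comp_neg {c : ℝ → X} (hc : Isometry c) : Isometry fun s => c (-s) :=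
  Isometry.of_dist_eq fun x y => by rw [hc.dist_eq, dist_neg_neg]

/-- A bounded convex function on `[a, ∞)` cannot increase. Convexity is applied on `[a, a + T]`,
with `T` so large that the far endpoint contributes at most `ε`. -/
lemma IsCAT0.dist_le_of_parallel (hX : IsCAT0 X) {c c' : ℝ → X} (hc : Isometry c)
    (hc' : Isometry c') {K : ℝ} (hK : ∀ s, dist (c s) (c' s) ≤ K) {a b : ℝ} (hab : a ≤ b) :
    dist (c b) (c' b) ≤ dist (c a) (c' a) := by
  refine le_of_forall_pos_le_add fun ε hε => ?_
  have hK0 : 0 ≤ K := dist_nonneg.trans (hK 0)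
  obtain ⟨T, hT⟩ : ∃ T : ℝ, T = (b - a + 1) * (K / ε + 1) := ⟨_, rfl⟩
  have hba : 0 ≤ b - a := by linarith
  have hKε : 0 ≤ K / ε := by positivity
  have hTpos : 0 < T := by rw [hT]; positivity
  have hTb : b - a ≤ T := by rw [hT]; nlinarith
  have hl : 0 ≤ (b - a) / T := by positivity
  have hl' : (b - a) / T ≤ 1 := (div_le_one hTpos).2 hTb
  have e : a + (b - a) / T * (a + T - a) = b := by field_simp; ring
  have h1 := hc.isPointAt (show a ≤ a + T by linarith) hl hl'
  have h2 := hc'.isPointAt (show a ≤ a + T by linarith) hl hl'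
  rw [e] at h1 h2
  have h3 := hX.dist_le_convex h1 h2
  have h4 : (b - a) / T * dist (c (a + T)) (c' (a + T)) ≤ ε := by
    have : (b - a) / T * K ≤ ε := by
      rw [div_mul_eq_mul_div, div_le_iff₀ hTpos, hT]
      have : ε * ((b - a + 1) * (K / ε + 1)) = (b - a + 1) * (K + ε) := by field_simp
      rw [this]; nlinarith
    exact (mul_le_mul_of_nonneg_left (hK _) hl).trans this
  have h5 : (1 - (b - a) / T) * dist (c a) (c' a) ≤ dist (c a) (c' a) :=
    mul_le_of_le_one_left dist_nonneg (by linarith)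
  linarith

lemma IsCAT0.dist_eq_of_parallel (hX : IsCAT0 X) {c c' : ℝ → X} (hc : Isometry c)
    (hc' : Isometry c') {K : ℝ} (hK : ∀ s, dist (c s) (c' s) ≤ K) (a b : ℝ) :
    dist (c b) (c' b) = dist (c a) (c' a) := by
  have key : ∀ a b, dist (c b) (c' b) ≤ dist (c a) (c' a) := by
    intro a b
    rcases le_total a b with hab | hab
    · exact hX.dist_le_of_parallel hc hc' hK hab
    · simpa using hX.dist_le_of_parallel hc.comp_neg hc'.comp_neg (fun s => hK (-s))
        (neg_le_neg hab)
  exact le_antisymm (key _ _) (key _ _)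

/-- The excess of a point of a line parallel to `c` over far away points of `c` is small. -/
lemma IsCAT0.excess_le (hX : IsCAT0 X) {c c' : ℝ → X} (hc : Isometry c)
    (hc' : Isometry c') {K : ℝ} (hK : ∀ s, dist (c s) (c' s) ≤ K) {N : ℝ} (hN : 0 < N) :
    dist (c (-N)) (c' 0) + dist (c' 0) (c N) ≤ 2 * N + K ^ 2 / N := by
  -- After a shift by `N`, `c` is still parallel to `c'`, so their distance is constant.
  have h1 : dist (c N) (c' 0) = dist (c 0) (c' (-N)) := by
    have := hX.dist_eq_of_parallel (hc.comp_add_right N) hc' (K := N + K) (fun s => by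
      refine (dist_triangle _ (c s) _).trans (add_le_add ?_ (hK s))
      rw [hc.dist_eq, Real.dist_eq, add_sub_cancel_left, abs_of_pos hN]) (-N) 0
    simpa using this
  have h2 := hX.quadrilateral (c (-N)) (c 0) (c' 0) (c' (-N))
  rw [dist_comm (c' 0) (c N), h1]
  have e1 : dist (c (-N)) (c 0) = N := by simp [hc.dist_eq, abs_of_pos hN]
  have e2 : dist (c' 0) (c' (-N)) = N := by simp [hc'.dist_eq, abs_of_pos hN]
  rw [e1, e2, dist_comm (c' (-N))] at h2
  have hK0 : 0 ≤ K := dist_nonneg.trans (hK 0)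
  have h3 : dist (c 0) (c' 0) ^ 2 ≤ K ^ 2 := by gcongr; exact hK 0
  have h4 : dist (c (-N)) (c' (-N)) ^ 2 ≤ K ^ 2 := by gcongr; exact hK _
  set α := dist (c (-N)) (c' 0)
  set β := dist (c 0) (c' (-N))
  refine abs_le_of_sq_le_sq' (b := 2 * N + K ^ 2 / N) ?_ (by positivity) |>.2
  have e3 : (2 * N + K ^ 2 / N) ^ 2 = 4 * N ^ 2 + 4 * K ^ 2 + (K ^ 2 / N) ^ 2 := by
    field_simp; ring
  rw [e3]
  nlinarith [sq_nonneg (α - β), sq_nonneg (K ^ 2 / N)]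

/-! ### Isometries and their axes. -/

lemma zpow_apply_dist (h : X ≃ᵢ X) (n : ℤ) (x y : X) : dist ((h ^ n) x) ((h ^ n) y) = dist x y :=
  (h ^ n).isometry.dist_eq x y

/-- An isometry translating a broken geodesic without corners has an axis. -/
lemma IsCAT0.exists_line (hX : IsCAT0 X) (h : X ≃ᵢ X) {γ : ℝ → X} {l s : ℝ} (hl : 0 < l)
    (hγ : ∀ a ∈ Icc 0 l, ∀ b ∈ Icc 0 l, dist (γ a) (γ b) = |a - b|) (hγl : h (γ 0) = γ l)
    (hs : 0 < s) (hsl : s ≤ l) (hopp : dist (γ (l - s)) (h (γ s)) = 2 * s) :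
    ∃ c : ℝ → X, Isometry c ∧ (∀ a ∈ Icc 0 l, c a = γ a) ∧ ∀ a, h (c a) = c (a + l) := by
  have m0 : (0 : ℝ) ∈ Icc 0 l := ⟨le_rfl, hl.le⟩
  have ml : l ∈ Icc 0 l := ⟨hl.le, le_rfl⟩
  have ms : s ∈ Icc 0 l := ⟨hs.le, hsl⟩
  have mls : l - s ∈ Icc 0 l := ⟨by linarith, by linarith⟩
  set y := γ 0 with hy
  -- The induction adds one translate at a time: at the vertex `(h ^ (k + 1)) y` the points at
  -- distance `s` on both sides are `2 * s` apart, so `IsCAT0.dist_eq_add_of_opposite` applies.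
  have hnat : ∀ n : ℕ, dist y ((h ^ n) y) = n * l := by
    intro n
    induction n with
    | zero => simp
    | succ n ih =>
      rcases Nat.eq_zero_or_pos n with rfl | hn
      · simp only [zero_add, pow_one, Nat.cast_one, one_mul]
        rw [hγl, hγ 0 m0 l ml, zero_sub, abs_neg, abs_of_pos hl]
      · obtain ⟨k, rfl⟩ : ∃ k, n = k + 1 := ⟨n - 1, by omega⟩
        have e1 : (h ^ (k + 1)) y = (h ^ k) (γ l) := by
          rw [pow_succ, IsometryEquiv.mul_apply, hγl]
        have e2 : (h ^ (k + 1 + 1)) y = (h ^ (k + 1)) (γ l) := by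
          rw [pow_succ, IsometryEquiv.mul_apply, hγl]
        have d1 : dist ((h ^ (k + 1)) y) ((h ^ k) (γ (l - s))) = s := by
          rw [e1, (h ^ k).isometry.dist_eq, hγ l ml _ mls, sub_sub_cancel, abs_of_pos hs]
        have d2 : dist ((h ^ (k + 1)) y) ((h ^ (k + 1)) (γ s)) = s := by
          rw [(h ^ (k + 1)).isometry.dist_eq, hγ 0 m0 s ms, zero_sub, abs_neg, abs_of_pos hs]
        have d3 : dist ((h ^ k) (γ (l - s))) ((h ^ (k + 1)) (γ s)) = 2 * s := by
          rw [pow_succ, IsometryEquiv.mul_apply, (h ^ k).isometry.dist_eq, hopp]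
        have d4 : dist ((h ^ (k + 1)) (γ s)) ((h ^ (k + 1 + 1)) y) = l - s := by
          rw [e2, (h ^ (k + 1)).isometry.dist_eq, hγ s ms l ml, abs_sub_comm,
            abs_of_nonneg (by linarith)]
        have d5 : dist ((h ^ (k + 1)) y) ((h ^ (k + 1 + 1)) y) = l := by
          rw [e2, (h ^ (k + 1)).isometry.dist_eq, hγ 0 m0 l ml, zero_sub, abs_neg, abs_of_pos hl]
        have hk : dist y ((h ^ k) y) ≤ k * l := by
          have : ∀ j : ℕ, dist y ((h ^ j) y) ≤ j * l := by
            intro j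
            induction j with
            | zero => simp
            | succ j ihj =>
              refine (dist_triangle _ ((h ^ j) y) _).trans ?_
              have : dist ((h ^ j) y) ((h ^ (j + 1)) y) = l := by
                rw [pow_succ, IsometryEquiv.mul_apply, (h ^ j).isometry.dist_eq, hγl, hγ 0 m0 l ml,
                  zero_sub, abs_neg, abs_of_pos hl]
              rw [this]; push_cast; linarith
          exact this k
        have d6 : dist ((h ^ k) (γ (l - s))) y ≤ (k + 1 : ℕ) * l - s := by
          have : dist ((h ^ k) (γ (l - s))) ((h ^ k) y) = l - s := by
            rw [(h ^ k).isometry.dist_eq, hγ _ mls 0 m0, sub_zero, abs_of_nonneg mls.1]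
          have h7 := dist_triangle ((h ^ k) (γ (l - s))) ((h ^ k) y) y
          rw [dist_comm _ y] at h7
          rw [dist_comm _ y]; push_cast; linarith [dist_comm y ((h ^ k) y)]
        have d7 := dist_triangle ((h ^ (k + 1)) y) ((h ^ k) (γ (l - s))) y
        have ih' := ih
        rw [dist_comm] at ih'
        have := hX.dist_eq_add_of_opposite hs d1 (by linarith) d2 (by linarith) d3
        rw [this, ih, d5]; push_cast; ring
  have hint : ∀ i j : ℤ, i ≤ j → dist ((h ^ i) y) ((h ^ j) y) = (j - i) * l := by
    intro i j hij
    obtain ⟨n, rfl⟩ := Int.le.dest hij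
    rw [zpow_add, IsometryEquiv.mul_apply, zpow_apply_dist, zpow_natCast, hnat]
    push_cast; ring
  set c : ℝ → X := fun t => (h ^ ⌊t / l⌋) (γ (t - ⌊t / l⌋ * l)) with hcdef
  have hmem : ∀ t : ℝ, t - ⌊t / l⌋ * l ∈ Icc 0 l := by
    intro t
    have h1 := Int.floor_le (t / l)
    have h2 := (Int.lt_floor_add_one (t / l)).le
    rw [le_div_iff₀ hl] at h1
    rw [div_le_iff₀ hl] at h2
    exact ⟨by linarith, by linarith⟩
  have hleft : ∀ t, dist ((h ^ ⌊t / l⌋) y) (c t) = t - ⌊t / l⌋ * l := fun t => by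
    rw [hcdef, zpow_apply_dist, hγ 0 m0 _ (hmem t), zero_sub, abs_neg, abs_of_nonneg (hmem t).1]
  have hright : ∀ t, dist (c t) ((h ^ (⌊t / l⌋ + 1)) y) = (⌊t / l⌋ + 1) * l - t := fun t => by
    rw [hcdef, zpow_add, zpow_one, IsometryEquiv.mul_apply, zpow_apply_dist, hγl,
      hγ _ (hmem t) l ml, abs_sub_comm, abs_of_nonneg (by linarith [(hmem t).2])]
    ring
  have hdist : ∀ a b, a ≤ b → dist (c a) (c b) = b - a := by
    intro a b hab
    have hfl : ⌊a / l⌋ ≤ ⌊b / l⌋ := Int.floor_le_floor (by gcongr)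
    apply le_antisymm
    · rcases hfl.eq_or_lt with heq | hlt
      · simp only [hcdef]
        rw [heq, zpow_apply_dist, hγ _ (by rw [← heq]; exact hmem a) _ (hmem b), abs_sub_comm,
          abs_of_nonneg (by linarith)]
        linarith
      · have h1 := dist_triangle4 (c a) ((h ^ (⌊a / l⌋ + 1)) y) ((h ^ ⌊b / l⌋) y) (c b)
        rw [hright, hleft, hint _ _ (by omega)] at h1
        push_cast at h1
        linarith
    -- The vertices just outside `[a, b]` have a known distance, which leaves no room for `c a` and
    -- `c b` to be closer.
    · have h1 := dist_triangle4 ((h ^ ⌊a / l⌋) y) (c a) (c b) ((h ^ (⌊b / l⌋ + 1)) y)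
      rw [hright, hleft, hint _ _ (by omega)] at h1
      push_cast at h1
      linarith
  refine ⟨c, Isometry.of_dist_eq fun a b => ?_, fun a ha => ?_, fun a => ?_⟩
  · rcases le_total a b with hab | hab
    · rw [hdist a b hab, Real.dist_eq, abs_sub_comm, abs_of_nonneg (by linarith)]
    · rw [dist_comm, hdist b a hab, Real.dist_eq, abs_of_nonneg (by linarith)]
  · rcases ha.2.eq_or_lt with rfl | hlt
    · simp [hcdef, hl.ne', hγl, ← hy]
    · have : ⌊a / l⌋ = 0 := by
        rw [Int.floor_eq_zero_iff]; exact ⟨by have := ha.1; positivity, (div_lt_one hl).2 hlt⟩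
      simp [hcdef, this]
  · have : ⌊(a + l) / l⌋ = ⌊a / l⌋ + 1 := by
      rw [add_div, div_self hl.ne', Int.floor_add_one]
    simp only [hcdef]
    rw [this, add_comm ⌊a / l⌋ 1, zpow_add, zpow_one, IsometryEquiv.mul_apply]
    congr 3
    push_cast; ring

lemma pow_apply_line {h : X ≃ᵢ X} {c : ℝ → X} {l : ℝ} (hh : ∀ s, h (c s) = c (s + l)) (k : ℕ)
    (s : ℝ) : (h ^ k) (c s) = c (s + k * l) := by
  induction k with
  | zero => simp
  | succ k ih =>
    rw [pow_succ', IsometryEquiv.mul_apply, ih, hh]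
    congr 1; push_cast; ring

lemma dist_pow_apply_le (h : X ≃ᵢ X) (x : X) (k : ℕ) : dist x ((h ^ k) x) ≤ k * dist x (h x) := by
  induction k with
  | zero => simp
  | succ k ih =>
    refine (dist_triangle _ ((h ^ k) x) _).trans ?_
    rw [pow_succ, IsometryEquiv.mul_apply, (h ^ k).isometry.dist_eq]
    push_cast; linarith

/-- The `k`-th power moves `c 0` by `k * l` and `x` by at most `k * dist x (h x)`. These differ by
at most `2 * dist x (c 0)`, independently of `k`. -/
lemma le_dist_apply_of_line {h : X ≃ᵢ X} {c : ℝ → X} (hc : Isometry c) {l : ℝ} (hl : 0 < l)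
    (hh : ∀ s, h (c s) = c (s + l)) (x : X) : l ≤ dist x (h x) := by
  by_contra! hlt
  obtain ⟨k, hk⟩ := exists_nat_gt (2 * dist x (c 0) / (l - dist x (h x)))
  have hpos : 0 < l - dist x (h x) := by linarith
  rw [div_lt_iff₀ hpos] at hk
  have h1 := dist_pow_apply_le h x k
  have h2 := dist_triangle4 (c 0) x ((h ^ k) x) ((h ^ k) (c 0))
  rw [(h ^ k).isometry.dist_eq, pow_apply_line hh, hc.dist_eq, Real.dist_eq, zero_sub, abs_neg,
    zero_add, abs_of_nonneg (by positivity), dist_comm (c 0)] at h2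
  linarith

lemma translationLength_eq_of_line {h : X ≃ᵢ X} {c : ℝ → X} (hc : Isometry c) {l : ℝ} (hl : 0 < l)
    (hh : ∀ s, h (c s) = c (s + l)) : translationLength h = l := by
  have : Nonempty X := ⟨c 0⟩
  refine le_antisymm ?_ (le_ciInf (le_dist_apply_of_line hc hl hh))
  refine (ciInf_le ⟨0, ?_⟩ (c 0)).trans ?_
  · rintro _ ⟨x, rfl⟩; exact dist_nonneg
  · rw [hh, hc.dist_eq, Real.dist_eq, zero_sub, abs_neg, zero_add, abs_of_pos hl]

lemma isHyperbolic_of_line {h : X ≃ᵢ X} {c : ℝ → X} (hc : Isometry c) {l : ℝ} (hl : 0 < l)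
    (hh : ∀ s, h (c s) = c (s + l)) : IsHyperbolic h := by
  have e := translationLength_eq_of_line hc hl hh
  refine ⟨by rwa [e], c 0, ?_⟩
  rw [minSet, mem_ofPred_eq, e, hh, hc.dist_eq, Real.dist_eq, zero_sub, abs_neg, zero_add,
    abs_of_pos hl]

lemma isTranslationAxis_of_line {h : X ≃ᵢ X} {c : ℝ → X} (hc : Isometry c) {l : ℝ} (hl : 0 < l)
    (hh : ∀ s, h (c s) = c (s + l)) : IsTranslationAxis h (range c) :=
  ⟨c, hc, rfl, by rwa [translationLength_eq_of_line hc hl hh]⟩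

/-- Every point of `Min(h)` lies on an axis. -/
lemma IsCAT0.exists_line_of_mem_minSet (hX : IsCAT0 X) {h : X ≃ᵢ X} (hl : 0 < translationLength h)
    {y : X} (hy : y ∈ minSet h) :
    ∃ c : ℝ → X, Isometry c ∧ c 0 = y ∧ ∀ s, h (c s) = c (s + translationLength h) := by
  obtain ⟨γ, h0, h1, hγ⟩ := hX.geodesic y (h y)
  rw [show dist y (h y) = translationLength h from hy] at h1 hγ
  set l := translationLength h with hldef
  have m0 : (0 : ℝ) ∈ Icc 0 l := ⟨le_rfl, hl.le⟩
  have ml : l ∈ Icc 0 l := ⟨hl.le, le_rfl⟩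
  have mh : l / 2 ∈ Icc 0 l := ⟨by linarith, by linarith⟩
  have hhalf : l - l / 2 = l / 2 := by ring
  -- A corner at `h y` would bring the midpoint of `[y, h y]` closer to its image than the
  -- translation length.
  obtain ⟨c, hc, hcγ, hch⟩ := hX.exists_line h hl hγ (by rw [h0, h1]) (s := l / 2) (by linarith)
    (by linarith) (by
      rw [hhalf]
      apply le_antisymm
      · refine (dist_triangle _ (h y) _).trans ?_
        rw [h.isometry.dist_eq, ← h1, ← h0, hγ _ mh _ ml, hγ _ m0 _ mh, zero_sub, abs_neg,
          abs_sub_comm, hhalf, abs_of_pos (by linarith)]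
        linarith
      · have : l ≤ dist (γ (l / 2)) (h (γ (l / 2))) :=
          ciInf_le ⟨0, by rintro _ ⟨x, rfl⟩; exact dist_nonneg⟩ _
        linarith)
  exact ⟨c, hc, by rw [hcγ 0 m0, h0], hch⟩

end CAT0

/-! ### Discrete orbits and recurrence along a line. -/

section Orbits

variable {X : Type*} [MetricSpace X]

lemma Set.finite_of_separated_of_isCompact {S K : Set X} (hK : IsCompact K) (hS : S ⊆ K) {ε : ℝ}
    (hε : 0 < ε) (hsep : ∀ x ∈ S, ∀ y ∈ S, dist x y < ε → x = y) : S.Finite := by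
  obtain ⟨T, hT, hcov⟩ := Metric.totallyBounded_iff.1 (hK.totallyBounded.subset hS) (ε / 2)
    (by linarith)
  have hch : ∀ x ∈ S, ∃ y ∈ T, dist x y < ε / 2 := fun x hx => by simpa using hcov hx
  choose! g hgT hg using hch
  refine hT.of_injOn (f := g) hgT fun x hx y hy hxy => hsep x hx y hy ?_
  have h1 := hg x hx
  have h2 := hg y hy
  rw [← hxy] at h2
  linarith [dist_triangle_right x y (g x)]

/-- By homogeneity, a radius isolating `x` in its orbit separates all pairs of orbit points; a
compact set then contains only finitely many. -/
lemma finite_isometryOrbit_inter_closedBall [ProperSpace X] {G : Subgroup (X ≃ᵢ X)} {x : X}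
    (hd : DiscreteTopology (isometryOrbit G x)) (z : X) (r : ℝ) :
    (isometryOrbit G x ∩ closedBall z r).Finite := by
  have hx : x ∈ isometryOrbit G x := ⟨1, G.one_mem, rfl⟩
  obtain ⟨ε, hε, hball⟩ := Metric.isOpen_iff.1 (isOpen_discrete {(⟨x, hx⟩ : isometryOrbit G x)})
    _ rfl
  refine Set.finite_of_separated_of_isCompact (isCompact_closedBall z r) inter_subset_right hε ?_
  rintro _ ⟨⟨g, hg, rfl⟩, -⟩ _ ⟨⟨k, hk, rfl⟩, -⟩ hlt
  have hmem : (k⁻¹ * g) x ∈ isometryOrbit G x := ⟨_, G.mul_mem (G.inv_mem hk) hg, rfl⟩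
  have hd' : dist ((k⁻¹ * g) x) x < ε := by
    rw [← k.isometry.dist_eq, ← IsometryEquiv.mul_apply, mul_inv_cancel_left]
    exact hlt
  have := congrArg Subtype.val (mem_singleton_iff.1 (hball (show (⟨_, hmem⟩ : isometryOrbit G x) ∈
    ball ⟨x, hx⟩ ε from hd')))
  simp only at this
  conv_rhs => rw [← this]
  rw [← IsometryEquiv.mul_apply, mul_inv_cancel_left]

lemma Ultrafilter.exists_eventually_eq {α β : Type*} (U : Ultrafilter α) {S : Set β} (hS : S.Finite)
    {f : α → β} (hf : ∀ᶠ a in U, f a ∈ S) : ∃ b ∈ S, ∀ᶠ a in U, f a = b := by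
  have : (⋃ b ∈ S, {a | f a = b}) ∈ U := by
    filter_upwards [hf] with a ha
    simpa using ha
  rwa [Ultrafilter.finite_biUnion_mem_iff hS] at this

lemma mem_isometryOrbit_iff {G : Subgroup (X ≃ᵢ X)} {x y : X} :
    y ∈ isometryOrbit G x ↔ isometryOrbit G y = isometryOrbit G x := by
  constructor
  · rintro ⟨g, hg, rfl⟩
    ext z
    constructor
    · rintro ⟨k, hk, rfl⟩
      exact ⟨k * g, G.mul_mem hk hg, rfl⟩
    · rintro ⟨k, hk, rfl⟩
      exact ⟨k * g⁻¹, G.mul_mem hk (G.inv_mem hg), by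
        rw [← IsometryEquiv.mul_apply, inv_mul_cancel_right]⟩
  · intro h
    rw [← h]
    exact ⟨1, G.one_mem, rfl⟩

/-- Along a subsequence, elements of `G` carry initial pieces of `ρ` to one another. -/
lemma exists_recurrent_subsequence [ProperSpace X] (G : Subgroup (X ≃ᵢ X)) (ρ : ℝ → X)
    (t : ℕ → ℝ) (ht_top : Tendsto t atTop atTop)
    (ht_gap : BddAbove (range fun n => dist (ρ (t n)) (ρ (t (n + 1)))))
    (h_fin : (range fun n => isometryOrbit G (ρ (t n))).Finite)
    (h_disc : ∀ n, DiscreteTopology (isometryOrbit G (ρ (t n)))) :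
    ∃ f : ℕ → ℕ, StrictMono f ∧ (∀ n, 0 < f n) ∧ (∀ n, t (f n) < t (f n + 1)) ∧
      ∀ m n, ∃ h ∈ G, h (ρ (t (f m))) = ρ (t (f n)) ∧ h (ρ (t (f m + 1))) = ρ (t (f n + 1)) := by
  -- Monotonicity is not assumed here, but a sequence tending to infinity must increase infinitely
  -- often.
  have hfreq : ∃ᶠ n in atTop, t n < t (n + 1) := by
    rw [Filter.frequently_atTop]
    intro N
    by_contra! hcon
    have hconst : ∀ k, t (N + k) ≤ t N := by
      intro k
      induction k with
      | zero => simp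
      | succ k ih => exact (hcon (N + k) (by omega)).trans ih
    obtain ⟨M, hM⟩ := (ht_top.eventually_gt_atTop (t N)).exists_forall_of_atTop
    exact absurd (hM (N + M) (by omega)) (not_lt.2 (hconst M))
  have hne : (atTop ⊓ 𝓟 {n | t n < t (n + 1)}).NeBot := Filter.frequently_iff_neBot.1 hfreq
  -- An ultrafilter allows successive pigeonhole choices without passing to further subsequences.
  set U := Ultrafilter.of (atTop ⊓ 𝓟 {n | t n < t (n + 1)})
  have hU : (U : Filter ℕ) ≤ atTop ⊓ 𝓟 {n | t n < t (n + 1)} := Ultrafilter.of_le _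
  have hUt : ∀ᶠ n in U, t n < t (n + 1) := hU (mem_inf_of_right (mem_principal_self _))
  have hUtop : (U : Filter ℕ) ≤ atTop := hU.trans inf_le_left
  obtain ⟨C, hC⟩ := ht_gap
  obtain ⟨_, ⟨n₀, rfl⟩, hO⟩ := U.exists_eventually_eq h_fin (.of_forall fun n => mem_range_self n)
  have hg : ∀ n, isometryOrbit G (ρ (t n)) = isometryOrbit G (ρ (t n₀)) →
      ∃ g ∈ G, g (ρ (t n)) = ρ (t n₀) := fun n hn => mem_isometryOrbit_iff.2 hn.symm
  choose! g hgG hg using hg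
  have hS : (⋃ O ∈ range fun n => isometryOrbit G (ρ (t n)),
      O ∩ closedBall (ρ (t n₀)) C).Finite := by
    refine h_fin.biUnion ?_
    rintro _ ⟨n, rfl⟩
    exact finite_isometryOrbit_inter_closedBall (h_disc n) _ _
  obtain ⟨b, -, hb⟩ := U.exists_eventually_eq (f := fun n => g n (ρ (t (n + 1)))) hS (by
    filter_upwards [hO] with n hn
    refine mem_biUnion (mem_range_self (n + 1)) ⟨⟨g n, hgG n hn, rfl⟩, ?_⟩
    rw [mem_closedBall, ← hg n hn, (g n).isometry.dist_eq, dist_comm]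
    exact hC (mem_range_self n))
  have hall : ∃ᶠ n in atTop, 0 < n ∧ t n < t (n + 1) ∧
      isometryOrbit G (ρ (t n)) = isometryOrbit G (ρ (t n₀)) ∧ g n (ρ (t (n + 1))) = b := by
    refine Filter.Frequently.filter_mono (Eventually.frequently ?_) hUtop
    filter_upwards [hUtop (eventually_gt_atTop 0), hUt, hO, hb] with n h1 h2 h3 h4
    exact ⟨h1, h2, h3, h4⟩
  obtain ⟨f, hf, hP⟩ := extraction_of_frequently_atTop hall
  refine ⟨f, hf, fun n => (hP n).1, fun n => (hP n).2.1, fun m n =>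
    ⟨(g (f n))⁻¹ * g (f m), G.mul_mem (G.inv_mem (hgG _ (hP n).2.2.1)) (hgG _ (hP m).2.2.1), ?_, ?_⟩⟩
  · rw [IsometryEquiv.mul_apply, hg _ (hP m).2.2.1, ← hg _ (hP n).2.2.1, ← IsometryEquiv.mul_apply,
      inv_mul_cancel]; rfl
  · rw [IsometryEquiv.mul_apply, (hP m).2.2.2, ← (hP n).2.2.2, ← IsometryEquiv.mul_apply,
      inv_mul_cancel]; rfl

/-- An isometry carrying an initial piece of a line to another piece of it, further ahead, has an
axis that contains the part of the line in between. -/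
lemma IsCAT0.exists_line_of_shift (hX : IsCAT0 X) {ρ : ℝ → X} (hρ : Isometry ρ) {h : X ≃ᵢ X}
    {a b a' b' : ℝ} (hab : a < b) (haa : a < a') (hbb : b < b') (ha : h (ρ a) = ρ b)
    (ha' : h (ρ a') = ρ b') :
    ∃ c : ℝ → X, Isometry c ∧ (∀ s ∈ Icc a b, c s = ρ s) ∧ ∀ s, h (c s) = c (s + (b - a)) := by
  have hlen : a' - a = b' - b := by
    have := h.isometry.dist_eq (ρ a') (ρ a)
    rwa [ha, ha', hρ.dist_eq, hρ.dist_eq, Real.dist_eq, Real.dist_eq, abs_of_pos (by linarith),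
      abs_of_pos (by linarith), eq_comm] at this
  -- Both sides trace the geodesic from `ρ b` to `ρ b'`, which is unique.
  have hshift : ∀ s, 0 ≤ s → s ≤ a' - a → h (ρ (a + s)) = ρ (b + s) := by
    intro s hs hs'
    have hpos : 0 < a' - a := by linarith
    have hl : 0 ≤ s / (a' - a) := by positivity
    have hl' : s / (a' - a) ≤ 1 := (div_le_one hpos).2 hs'
    have h1 := (h.isometry.comp hρ).isPointAt haa.le hl hl'
    have h2 := hρ.isPointAt hbb.le hl hl'
    simp only [Function.comp, ha, ha'] at h1
    rw [div_mul_cancel₀ _ hpos.ne'] at h1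
    rw [← hlen, div_mul_cancel₀ _ hpos.ne'] at h2
    exact hX.eq_of_isPointAt h1 h2
  -- There is no corner at `ρ b`: the two nearby points are `ρ (b - s)` and `h (ρ (a + s)) = ρ (b +
  -- s)`, both on `ρ`.
  obtain ⟨c, hc, hcγ, hch⟩ := hX.exists_line h (γ := fun s => ρ (a + s)) (l := b - a)
    (s := min (b - a) (a' - a)) (by linarith) (fun x _ y _ => by simp [hρ.dist_eq, Real.dist_eq])
    (by simp [ha]) (lt_min (by linarith) (by linarith)) (min_le_left _ _) (by
      have hpos : 0 < min (b - a) (a' - a) := lt_min (by linarith) (by linarith)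
      rw [hshift _ hpos.le (min_le_right _ _), hρ.dist_eq, Real.dist_eq, abs_sub_comm,
        abs_of_nonneg (by linarith)]
      ring)
  refine ⟨fun s => c (s + -a), hc.comp_add_right _, fun s hs => ?_, fun s => ?_⟩
  · simp only
    rw [hcγ _ ⟨by linarith [hs.1], by linarith [hs.2]⟩]
    congr 1; ring
  · simp only
    rw [hch]
    congr 1; ring

end Orbits

/-! ### Walls of a Euclidean reflection group. -/

section WallGeometry

variable {d : ℕ} {W : Subgroup (EuclideanSpace ℝ (Fin d) ≃ᵃⁱ[ℝ] EuclideanSpace ℝ (Fin d))}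

lemma Set.Finite.exists_pos_forall_le {α : Type*} {S : Set α} (hS : S.Finite) {f : α → ℝ}
    (hf : ∀ a ∈ S, 0 < f a) : ∃ ε > 0, ∀ a ∈ S, ε ≤ f a := by
  rcases S.eq_empty_or_nonempty with rfl | hne
  · exact ⟨1, one_pos, by simp⟩
  · obtain ⟨a, ha, h⟩ := Set.exists_min_image S f hS hne
    exact ⟨f a, hf a ha, h⟩

lemma AffineIsometryEquiv.apply_add {d : ℕ}
    (w : EuclideanSpace ℝ (Fin d) ≃ᵃⁱ[ℝ] EuclideanSpace ℝ (Fin d))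
    (x y : EuclideanSpace ℝ (Fin d)) : w (x + y) = w x + w.linearIsometryEquiv y := by
  have := w.map_vadd x y
  rwa [vadd_eq_add, vadd_eq_add, add_comm y, add_comm _ (w x)] at this

lemma IsWall.norm_eq_one {v : EuclideanSpace ℝ (Fin d)} {c : ℝ} (h : IsWall W v c) : ‖v‖ = 1 := by
  obtain ⟨g, -, hv, -⟩ := h
  exact hv

lemma IsWall.neg {v : EuclideanSpace ℝ (Fin d)} {c : ℝ} (h : IsWall W v c) :
    IsWall W (-v) (-c) := by
  obtain ⟨g, hg, hv, hgx⟩ := h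
  refine ⟨g, hg, by rwa [norm_neg], fun x => ?_⟩
  rw [hgx, inner_neg_left]
  module

/-- The Weyl group permutes the walls. -/
lemma IsWall.map {v : EuclideanSpace ℝ (Fin d)} {c : ℝ} (h : IsWall W v c)
    {w : EuclideanSpace ℝ (Fin d) ≃ᵃⁱ[ℝ] EuclideanSpace ℝ (Fin d)} (hw : w ∈ W) :
    ∃ c', IsWall W (w.linearIsometryEquiv v) c' ∧
      ∀ x, inner ℝ (w.linearIsometryEquiv v) (w x) - c' = inner ℝ v x - c := by
  obtain ⟨g, hg, hv, hgx⟩ := h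
  have hin : ∀ x, inner ℝ (w.linearIsometryEquiv v) (w x)
      = inner ℝ v x + inner ℝ (w.linearIsometryEquiv v) (w 0) := fun x => by
    have := w.apply_add 0 x
    rw [zero_add] at this
    rw [this, inner_add_right, LinearIsometryEquiv.inner_map_map, add_comm]
  refine ⟨c + inner ℝ (w.linearIsometryEquiv v) (w 0),
    ⟨w * g * w⁻¹, W.mul_mem (W.mul_mem hw hg) (W.inv_mem hw), ?_, fun x => ?_⟩, fun x => ?_⟩
  · rwa [LinearIsometryEquiv.norm_map]
  · obtain ⟨y, rfl⟩ := w.surjective x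
    have : (w * g * w⁻¹) (w y) = w (g y) := by
      simp [AffineIsometryEquiv.coe_mul, AffineIsometryEquiv.coe_inv]
    rw [this, hgx, sub_eq_add_neg, w.apply_add, hin, ← neg_smul, map_smul]
    module
  · rw [hin]; ring

/-- The unit normal vectors of the walls. -/
def wallNormals (W : Subgroup (EuclideanSpace ℝ (Fin d) ≃ᵃⁱ[ℝ] EuclideanSpace ℝ (Fin d))) :
    Set (EuclideanSpace ℝ (Fin d)) := {v | ∃ c, IsWall W v c}

lemma norm_eq_one_of_mem_wallNormals {v : EuclideanSpace ℝ (Fin d)} (h : v ∈ wallNormals W) :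
    ‖v‖ = 1 := h.choose_spec.norm_eq_one

lemma neg_mem_wallNormals {v : EuclideanSpace ℝ (Fin d)} (h : v ∈ wallNormals W) :
    -v ∈ wallNormals W := ⟨_, h.choose_spec.neg⟩

lemma map_mem_wallNormals {v : EuclideanSpace ℝ (Fin d)} (h : v ∈ wallNormals W)
    {w : EuclideanSpace ℝ (Fin d) ≃ᵃⁱ[ℝ] EuclideanSpace ℝ (Fin d)} (hw : w ∈ W) :
    w.linearIsometryEquiv v ∈ wallNormals W :=
  let ⟨_, hc⟩ := h
  let ⟨c', hc', _⟩ := hc.map hw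
  ⟨c', hc'⟩

lemma symm_map_mem_wallNormals {v : EuclideanSpace ℝ (Fin d)} (h : v ∈ wallNormals W)
    {w : EuclideanSpace ℝ (Fin d) ≃ᵃⁱ[ℝ] EuclideanSpace ℝ (Fin d)} (hw : w ∈ W) :
    w.linearIsometryEquiv.symm v ∈ wallNormals W := by
  have e : (w⁻¹).linearIsometryEquiv = w.linearIsometryEquiv.symm := rfl
  rw [← e]
  exact map_mem_wallNormals h (W.inv_mem hw)

lemma isRegularPoint_map {x : EuclideanSpace ℝ (Fin d)} (hx : IsRegularPoint W x)
    {w : EuclideanSpace ℝ (Fin d) ≃ᵃⁱ[ℝ] EuclideanSpace ℝ (Fin d)} (hw : w ∈ W) :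
    IsRegularPoint W (w x) := by
  intro v c hv heq
  obtain ⟨c', hc', h⟩ := hv.map (W.inv_mem hw)
  refine hx _ c' hc' ?_
  have h1 := h (w x)
  have h2 : w⁻¹ (w x) = x := by simp [AffineIsometryEquiv.coe_inv]
  rw [h2, heq, sub_self] at h1
  linarith

lemma infDist_hyperplane_le {v : EuclideanSpace ℝ (Fin d)} (hv : ‖v‖ = 1) (c : ℝ)
    (e : EuclideanSpace ℝ (Fin d)) :
    ∃ y ∈ hyperplane v c, dist e y = |inner ℝ v e - c| := by
  refine ⟨e - (inner ℝ v e - c) • v, ?_, ?_⟩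
  · simp [hyperplane, inner_sub_right, inner_smul_right, hv]
  · rw [dist_eq_norm, sub_sub_cancel, norm_smul, hv, mul_one, Real.norm_eq_abs]

/-- The walls that do not pass through a point stay away from it. -/
lemma IsEuclideanReflectionGroup.exists_gap (hW : IsEuclideanReflectionGroup W)
    (e : EuclideanSpace ℝ (Fin d)) :
    ∃ η > 0, ∀ v c, IsWall W v c → inner ℝ v e ≠ c → η ≤ |inner ℝ v e - c| := by
  have hclosed : ∀ v c, IsClosed (hyperplane (d := d) v c) := fun v c =>
    isClosed_eq (by fun_prop) continuous_const
  obtain ⟨η, hη, h⟩ := ((hW.locallyFinite e 1).subset (sep_subset _ fun H => e ∉ H)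
    ).exists_pos_forall_le (f := fun H => infDist e H) (by
      rintro _ ⟨⟨v, c, -, rfl, hne⟩, he⟩
      exact ((hclosed v c).notMem_iff_infDist_pos (hne.mono inter_subset_left)).1 he)
  refine ⟨min η 1, by positivity, fun v c hv hne => ?_⟩
  obtain ⟨y, hy, hd⟩ := infDist_hyperplane_le hv.norm_eq_one c e
  rcases le_total |inner ℝ v e - c| 1 with h1 | h1
  · refine (min_le_left _ _).trans ((h (hyperplane v c) ⟨⟨v, c, hv, rfl, y, hy, ?_⟩, hne⟩).trans ?_)
    · rwa [mem_closedBall, dist_comm, hd]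
    · exact (infDist_le_dist_of_mem hy).trans hd.le
  · exact (min_le_right _ _).trans h1

lemma eq_or_eq_neg_of_hyperplane_eq {v v' : EuclideanSpace ℝ (Fin d)} {c c' : ℝ} (hv : ‖v‖ = 1)
    (hv' : ‖v'‖ = 1) (h : hyperplane v c = hyperplane v' c') : v' = v ∨ v' = -v := by
  set z := v' - (inner ℝ v v') • v with hz
  have hvv : inner ℝ v v = (1 : ℝ) := by rw [real_inner_self_eq_norm_sq, hv, one_pow]
  have hzv : inner ℝ v z = 0 := by
    rw [hz, inner_sub_right, inner_smul_right, hvv]; ring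
  have h1 : c • v ∈ hyperplane v' c' := by
    rw [← h, hyperplane, mem_ofPred_eq, inner_smul_right, hvv, mul_one]
  have h2 : c • v + z ∈ hyperplane v' c' := by
    rw [← h, hyperplane, mem_ofPred_eq, inner_add_right, inner_smul_right, hvv, hzv]; ring
  have h3 : inner ℝ v' z = 0 := by
    rw [hyperplane, mem_ofPred_eq] at h1 h2
    rw [inner_add_right, h1] at h2; linarith
  have h4 : inner ℝ z z = 0 := by
    nth_rewrite 1 [hz]
    rw [inner_sub_left, inner_smul_left, h3, hzv]; simp
  have h5 : v' = (inner ℝ v v') • v := by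
    rw [inner_self_eq_zero] at h4
    exact sub_eq_zero.1 h4
  have h6 : |inner ℝ v v'| = 1 := by
    have := congrArg norm h5
    rwa [norm_smul, hv, hv', mul_one, Real.norm_eq_abs, eq_comm] at this
  rcases (abs_eq zero_le_one).1 h6 with h7 | h7 <;> rw [h7] at h5
  · left; simpa using h5
  · right; simpa using h5

lemma exists_mem_hyperplane_inter {v₁ v₂ : EuclideanSpace ℝ (Fin d)} (h₁ : ‖v₁‖ = 1)
    (h₂ : ‖v₂‖ = 1) (hne : v₁ ≠ v₂) (hne' : v₁ ≠ -v₂) (c₁ c₂ : ℝ) :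
    ∃ p, inner ℝ v₁ p = c₁ ∧ inner ℝ v₂ p = c₂ := by
  set a : ℝ := inner ℝ v₁ v₂ with ha
  have ha1 : a ≠ 1 := fun h => hne ((inner_eq_one_iff_of_norm_eq_one h₁ h₂).1 h)
  have ha2 : a ≠ -1 := fun h => hne' ((inner_eq_neg_one_iff_of_norm_eq_one h₁ h₂).1 h)
  have h3 : 1 - a ^ 2 ≠ 0 := by
    have : 1 - a ^ 2 = (1 - a) * (1 + a) := by ring
    rw [this]
    exact mul_ne_zero (sub_ne_zero.2 ha1.symm) fun h => ha2 (by linarith)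
  have e1 : inner ℝ v₁ v₁ = (1 : ℝ) := by rw [real_inner_self_eq_norm_sq, h₁, one_pow]
  have e2 : inner ℝ v₂ v₂ = (1 : ℝ) := by rw [real_inner_self_eq_norm_sq, h₂, one_pow]
  have e3 : inner ℝ v₂ v₁ = a := by rw [real_inner_comm]
  refine ⟨((c₁ - a * c₂) / (1 - a ^ 2)) • v₁ + ((c₂ - a * c₁) / (1 - a ^ 2)) • v₂, ?_, ?_⟩ <;>
    rw [inner_add_right, inner_smul_right, inner_smul_right]
  · rw [e1, ← ha]; field_simp; ring
  · rw [e2, e3]; field_simp; ring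

/-- Two walls with non-parallel normals meet, and `W` moves a common point into a fixed ball. So
every inner product of such normals already occurs among the finitely many normals of walls meeting
that ball. Inner products are thus bounded away from `1`, and the normals are uniformly separated on
the unit sphere. -/
lemma IsEuclideanReflectionGroup.finite_wallNormals (hW : IsEuclideanReflectionGroup W) :
    (wallNormals W).Finite := by
  obtain ⟨R, hR⟩ := hW.cocompact
  set M : Set (EuclideanSpace ℝ (Fin d)) :=
    {v | ∃ c, IsWall W v c ∧ (hyperplane v c ∩ closedBall 0 R).Nonempty} with hM
  have hMfin : M.Finite := by
    have hsub : M ⊆ ⋃ H ∈ {H | ∃ v c, IsWall W v c ∧ H = hyperplane v c ∧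
        (H ∩ closedBall 0 R).Nonempty}, {v | ‖v‖ = 1 ∧ ∃ c, H = hyperplane v c} := by
      rintro v ⟨c, hv, hne⟩
      exact mem_biUnion (x := hyperplane v c) ⟨v, c, hv, rfl, hne⟩ ⟨hv.norm_eq_one, c, rfl⟩
    refine ((hW.locallyFinite 0 R).biUnion ?_).subset hsub
    rintro _ ⟨v, c, hv, rfl, -⟩
    refine (Set.toFinite {v, -v}).subset ?_
    rintro v' ⟨hv', c', h⟩
    exact eq_or_eq_neg_of_hyperplane_eq hv.norm_eq_one hv' h
  have hMone : ∀ v ∈ M, ‖v‖ = 1 := fun v ⟨c, hv, _⟩ => hv.norm_eq_one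
  obtain ⟨ε, hε, h⟩ := ((hMfin.image2 (fun v w => (inner ℝ v w : ℝ)) hMfin).subset
    (sep_subset _ fun a => a ≠ 1)).exists_pos_forall_le (f := fun a => 1 - a) (by
      rintro _ ⟨⟨v, hv, w, hw, rfl⟩, hne⟩
      have := real_inner_le_norm v w
      rw [hMone v hv, hMone w hw, mul_one] at this
      exact sub_pos.2 (lt_of_le_of_ne this hne))
  refine Set.finite_of_separated_of_isCompact (isCompact_closedBall 0 1) (fun v hv => by
    simp [norm_eq_one_of_mem_wallNormals hv]) (ε := min 1 ε) (by positivity) ?_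
  intro v₁ hv₁ v₂ hv₂ hlt
  by_contra hne
  have n1 := norm_eq_one_of_mem_wallNormals hv₁
  have n2 := norm_eq_one_of_mem_wallNormals hv₂
  have hne' : v₁ ≠ -v₂ := by
    rintro rfl
    rw [dist_eq_norm, ← neg_add', norm_neg, ← two_smul ℝ, norm_smul, n2] at hlt
    have := hlt.trans_le (min_le_left _ _)
    norm_num at this
  obtain ⟨c₁, hc₁⟩ := hv₁
  obtain ⟨c₂, hc₂⟩ := hv₂
  obtain ⟨p, hp₁, hp₂⟩ := exists_mem_hyperplane_inter n1 n2 hne hne' c₁ c₂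
  obtain ⟨w, hw, hwR⟩ := hR p 0
  have hmem : ∀ v c, IsWall W v c → inner ℝ v p = c → w.linearIsometryEquiv v ∈ M := by
    intro v c hv hp
    obtain ⟨c', hc', hh⟩ := hv.map hw
    refine ⟨c', hc', w p, ?_, hwR⟩
    have := hh p
    rw [hp, sub_self] at this
    exact sub_eq_zero.1 this
  have hin : inner ℝ v₁ v₂ ≠ (1 : ℝ) := fun h => hne ((inner_eq_one_iff_of_norm_eq_one n1 n2).1 h)
  have h1 := h (inner ℝ v₁ v₂) ⟨⟨_, hmem v₁ c₁ hc₁ hp₁, _, hmem v₂ c₂ hc₂ hp₂,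
    w.linearIsometryEquiv.inner_map_map _ _⟩, hin⟩
  have h2 := @norm_sub_sq_real _ _ _ v₁ v₂
  rw [n1, n2, ← dist_eq_norm] at h2
  have h3 := hlt.trans_le (min_le_left _ _)
  have h4 := hlt.trans_le (min_le_right _ _)
  nlinarith [dist_nonneg (x := v₁) (y := v₂)]

/-- This says that the normals span. For `z` orthogonal to all of them, `inner ℝ z` is invariant
under reflections, hence under `W`; the orbit of `0` then stays in `z⊥`, contrary to cocompactness.
-/
lemma IsEuclideanReflectionGroup.eq_zero_of_forall_inner_eq_zero
    (hW : IsEuclideanReflectionGroup W) {z : EuclideanSpace ℝ (Fin d)}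
    (hz : ∀ v ∈ wallNormals W, inner ℝ v z = 0) : z = 0 := by
  have hinv : ∀ w ∈ W, ∀ x, inner ℝ z (w x) = inner ℝ z x := by
    intro w hw
    rw [← hW.generated] at hw
    induction hw using Subgroup.closure_induction with
    | mem g hg =>
      obtain ⟨hg, v, c, hv⟩ := hg
      intro x
      rw [hv.2, inner_sub_right, inner_smul_right, real_inner_comm v z, hz v ⟨c, g, hg, hv⟩]
      simp
    | one => simp
    | mul g k _ _ h1 h2 => intro x; rw [AffineIsometryEquiv.coe_mul, Function.comp, h1, h2]
    | inv g _ h1 =>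
      intro x
      have := h1 (g⁻¹ x)
      rw [← this]; simp [AffineIsometryEquiv.coe_inv]
  obtain ⟨R, hR⟩ := hW.cocompact
  by_contra hne
  have hpos : 0 < ‖z‖ := norm_pos_iff.2 hne
  set s := (|R| + 1) / ‖z‖ with hs
  obtain ⟨w, hw, hd⟩ := hR 0 (s • z)
  have h1 : inner ℝ z (s • z - w 0) = s * ‖z‖ ^ 2 := by
    rw [inner_sub_right, hinv w hw, inner_smul_right, real_inner_self_eq_norm_sq]; simp
  have h2 := real_inner_le_norm z (s • z - w 0)
  rw [h1, ← dist_eq_norm, dist_comm] at h2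
  have h3 : s * ‖z‖ ^ 2 = ‖z‖ * (|R| + 1) := by rw [hs]; field_simp
  rw [h3] at h2
  have h4 := le_of_mul_le_mul_left h2 hpos
  linarith [le_abs_self R]

lemma IsEuclideanReflectionGroup.linearIsometryEquiv_ext (hW : IsEuclideanReflectionGroup W)
    {L₁ L₂ : EuclideanSpace ℝ (Fin d) ≃ₗᵢ[ℝ] EuclideanSpace ℝ (Fin d)}
    (h : ∀ v ∈ wallNormals W, L₁ v = L₂ v) : L₁ = L₂ := by
  ext1 z
  have : L₂.symm (L₁ z) - z = 0 := by
    refine hW.eq_zero_of_forall_inner_eq_zero fun v hv => ?_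
    rw [inner_sub_right, ← L₂.inner_map_map v, L₂.apply_symm_apply, ← h v hv, L₁.inner_map_map,
      sub_self]
  rw [sub_eq_zero, LinearIsometryEquiv.symm_apply_eq] at this
  exact this

/-- An element is determined by its value at `x` and its permutation of the finite spanning set of
normals. -/
lemma IsEuclideanReflectionGroup.finite_transporter (hW : IsEuclideanReflectionGroup W)
    (x y : EuclideanSpace ℝ (Fin d)) : {w | w ∈ W ∧ w x = y}.Finite := by
  have := hW.finite_wallNormals.to_subtype
  rw [← Set.finite_coe_iff]
  refine Finite.of_injective (β := wallNormals W → wallNormals W)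
    (fun w v => ⟨_, map_mem_wallNormals v.2 w.2.1⟩) ?_
  rintro ⟨w₁, hw₁, h₁⟩ ⟨w₂, hw₂, h₂⟩ heq
  have hL : w₁.linearIsometryEquiv = w₂.linearIsometryEquiv :=
    hW.linearIsometryEquiv_ext fun v hv => congrArg Subtype.val (congrFun heq ⟨v, hv⟩)
  refine Subtype.ext (AffineIsometryEquiv.ext fun z => ?_)
  have e1 := w₁.apply_add x (z - x)
  have e2 := w₂.apply_add x (z - x)
  rw [add_sub_cancel] at e1 e2
  rw [e1, e2, h₁, h₂, hL]

lemma IsEuclideanReflectionGroup.exists_pos_le_abs_inner (hW : IsEuclideanReflectionGroup W)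
    {u : EuclideanSpace ℝ (Fin d)} (hu : IsRegularDirection W u) :
    ∃ ε > 0, ∀ v ∈ wallNormals W, ε ≤ |inner ℝ v u| :=
  hW.finite_wallNormals.exists_pos_forall_le fun v ⟨c, hc⟩ => abs_pos.2 (hu v c hc)

/-! ### Weyl chambers and closed cells. -/

lemma IsRegularDirection.neg {u : EuclideanSpace ℝ (Fin d)} (hu : IsRegularDirection W u) :
    IsRegularDirection W (-u) := fun v c hv => by
  rw [inner_neg_right]; exact neg_ne_zero.2 (hu v c hv)

lemma mem_weylChamber_of_norm_sub_lt {u z : EuclideanSpace ℝ (Fin d)} {ε a : ℝ} (ha : 0 ≤ a)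
    (hε : ∀ v ∈ wallNormals W, ε ≤ |inner ℝ v u|) (h : ‖z - a • u‖ < a * ε) :
    z ∈ weylChamber W u := by
  intro v c hv hpos
  have h1 := hε v ⟨c, hv⟩
  rw [abs_of_pos hpos] at h1
  have h2 := abs_le.1 (abs_real_inner_le_norm v (z - a • u)) |>.1
  rw [hv.norm_eq_one, one_mul, inner_sub_right, inner_smul_right] at h2
  nlinarith [mul_le_mul_of_nonneg_left h1 ha]

lemma inner_neg_of_mem_weylChamber {u z : EuclideanSpace ℝ (Fin d)} (hz : z ∈ weylChamber W u)
    {v : EuclideanSpace ℝ (Fin d)} {c : ℝ} (hv : IsWall W v c) (h : inner ℝ v u < 0) :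
    inner ℝ v z < 0 := by
  have := hz _ _ hv.neg (by rw [inner_neg_left]; linarith)
  rw [inner_neg_left] at this
  linarith

lemma isRegularDirection_of_mem_weylChamber {u z : EuclideanSpace ℝ (Fin d)}
    (hu : IsRegularDirection W u) (hz : z ∈ weylChamber W u) : IsRegularDirection W z := by
  intro v c hv
  rcases lt_or_gt_of_ne (hu v c hv) with h | h
  · exact (inner_neg_of_mem_weylChamber hz hv h).ne
  · exact (hz v c hv h).ne'

/-- Near `e`, the cone with apex `e` over a Weyl chamber lies in a single closed cell. -/
lemma add_smul_mem_closedCell {e u z z' : EuclideanSpace ℝ (Fin d)} {η τ τ' : ℝ}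
    (hη : ∀ v c, IsWall W v c → inner ℝ v e ≠ c → η ≤ |inner ℝ v e - c|)
    (hu : IsRegularDirection W u) (hz : z ∈ weylChamber W u) (hz' : z' ∈ weylChamber W u)
    (hτ : 0 < τ) (hτ' : 0 ≤ τ') (h : τ * ‖z‖ < η) (h' : τ' * ‖z'‖ < η) :
    e + τ' • z' ∈ closedCell W (e + τ • z) := by
  intro v c hv hle
  rw [inner_add_right, inner_smul_right] at hle ⊢
  have b1 := abs_le.1 (abs_real_inner_le_norm v z)
  have b2 := abs_le.1 (abs_real_inner_le_norm v z')
  rw [hv.norm_eq_one, one_mul] at b1 b2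
  have b1' := mul_le_mul_of_nonneg_left b1.1 hτ.le
  have b2' := mul_le_mul_of_nonneg_left b2.2 hτ'
  -- For a wall through `e` the Weyl chamber decides the side; every other wall is at least `η` away
  -- from `e` and is not reached.
  by_cases he : inner ℝ v e = c
  · rw [he] at hle ⊢
    have hz0 : inner ℝ v z ≤ 0 := by
      by_contra! hpos
      nlinarith
    have hu0 : inner ℝ v u < 0 := by
      refine lt_of_le_of_ne ?_ (hu v c hv)
      by_contra! hpos
      exact absurd (hz v c hv hpos) (not_lt.2 hz0)
    nlinarith [inner_neg_of_mem_weylChamber hz' hv hu0]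
  · have hg := hη v c hv he
    rcases lt_or_gt_of_ne he with hlt | hgt
    · rw [abs_of_neg (by linarith)] at hg
      linarith
    · rw [abs_of_pos (by linarith)] at hg
      linarith

/-- A closed convex union of closed cells that contains a long segment in a regular direction
contains a large ball around the midpoint. -/
lemma mem_of_convex_of_closedCell_subset (hW : IsEuclideanReflectionGroup W)
    {K : Set (EuclideanSpace ℝ (Fin d))} (hK : Convex ℝ K) (hKc : IsClosed K)
    (hcell : ∀ x ∈ K, closedCell W x ⊆ K) {p u : EuclideanSpace ℝ (Fin d)}
    (hu : IsRegularDirection W u) {ε N : ℝ} (hε : ∀ v ∈ wallNormals W, ε ≤ |inner ℝ v u|)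
    (hN : 0 < N) (h₁ : p + N • u ∈ K) (h₂ : p - N • u ∈ K)
    {y : EuclideanSpace ℝ (Fin d)} (hy : ‖y - p‖ < N * ε) : y ∈ K := by
  set q := p + N • u with hq
  -- Move from `q` towards `y` and stop at the last point `e` still known to be in `K`. If `e ≠ y`,
  -- the segment from `e` to `p - N • u` lies in `K` by convexity and starts in the same cell as the
  -- continuation towards `y`, which contradicts minimality of `θ`.
  set S : Set ℝ := {θ | θ ∈ Icc (0 : ℝ) 1 ∧ y + θ • (q - y) ∈ K} with hS
  have hSc : IsCompact S := by
    refine isCompact_Icc.of_isClosed_subset ?_ (sep_subset _ _)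
    exact isClosed_Icc.inter (hKc.preimage (by fun_prop))
  have hSne : S.Nonempty := ⟨1, ⟨zero_le_one, le_rfl⟩, by simpa using h₁⟩
  obtain ⟨θ, ⟨⟨hθ0, hθ1⟩, hθK⟩, hmin⟩ := hSc.exists_isLeast hSne
  rcases hθ0.eq_or_lt with rfl | hθ
  · simpa using hθK
  exfalso
  set e := y + θ • (q - y) with he
  obtain ⟨η, hη, hgap⟩ := hW.exists_gap e
  have hε' : ∀ v ∈ wallNormals W, ε ≤ |inner ℝ v (-u)| := by simpa using hε
  have hz' : y - q ∈ weylChamber W (-u) := by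
    refine mem_weylChamber_of_norm_sub_lt hN.le hε' ?_
    convert! hy using 2
    rw [hq]; module
  have hz : (p - N • u) - e ∈ weylChamber W (-u) := by
    refine mem_weylChamber_of_norm_sub_lt (a := N * (1 + θ)) (by positivity) hε' ?_
    have e1 : (p - N • u) - e - (N * (1 + θ)) • (-u) = -((1 - θ) • (y - p)) := by
      rw [he, hq]; module
    rw [e1, norm_neg, norm_smul, Real.norm_of_nonneg (by linarith)]
    have h3 : (1 - θ) * ‖y - p‖ ≤ ‖y - p‖ := mul_le_of_le_one_left (norm_nonneg _) (by linarith)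
    nlinarith [(norm_nonneg (y - p)).trans_lt hy]
  have small : ∀ a b : ℝ, 0 ≤ a → 0 < b → ∃ τ, 0 < τ ∧ τ ≤ b ∧ τ * a < η := by
    intro a b ha hb
    refine ⟨min b (η / (a + 1)), by positivity, min_le_left _ _, ?_⟩
    have : min b (η / (a + 1)) * (a + 1) ≤ η := by
      have := min_le_right b (η / (a + 1))
      rwa [le_div_iff₀ (by linarith)] at this
    nlinarith [show 0 < min b (η / (a + 1)) by positivity]
  obtain ⟨τ, hτ, hτ1, hτη⟩ := small ‖(p - N • u) - e‖ 1 (norm_nonneg _) one_pos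
  obtain ⟨τ', hτ', hτθ, hτη'⟩ := small ‖y - q‖ θ (norm_nonneg _) hθ
  have hmem : e + τ • ((p - N • u) - e) ∈ K := hK.add_smul_sub_mem hθK h₂ ⟨hτ.le, hτ1⟩
  have h4 := hcell _ hmem (add_smul_mem_closedCell hgap hu.neg hz hz' hτ hτ'.le hτη hτη')
  have h5 : θ - τ' ∈ S := by
    refine ⟨⟨by linarith, by linarith⟩, ?_⟩
    convert! h4 using 1
    rw [he]; module
  linarith [hmin h5]

/-! ### Regular points and affine maps preserving them. -/

lemma IsRegularPoint.exists_ball_subset_closedCell (hW : IsEuclideanReflectionGroup W)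
    {q : EuclideanSpace ℝ (Fin d)} (hq : IsRegularPoint W q) :
    ∃ η > 0, ball q η ⊆ closedCell W q := by
  obtain ⟨η, hη, hgap⟩ := hW.exists_gap q
  refine ⟨η, hη, fun y hy v c hv hle => ?_⟩
  have h1 := hgap v c hv (hq v c hv)
  rw [abs_of_nonpos (by linarith)] at h1
  have h2 := real_inner_le_norm v (y - q)
  rw [hv.norm_eq_one, one_mul, inner_sub_right, ← dist_eq_norm] at h2
  have h3 := mem_ball.1 hy
  linarith

/-- A wall through `q` separates points of every ball around `q`, so no such ball fits into one
closed chamber. The criterion mentions only chambers and balls, so automorphisms transport it. -/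
lemma isRegularPoint_iff (hW : IsEuclideanReflectionGroup W) {q : EuclideanSpace ℝ (Fin d)} :
    IsRegularPoint W q ↔ ∃ q', IsRegularPoint W q' ∧ ∃ η > 0, ball q η ⊆ closedCell W q' := by
  constructor
  · exact fun hq => ⟨q, hq, hq.exists_ball_subset_closedCell hW⟩
  · rintro ⟨q', hq', η, hη, hball⟩
    have key : ∀ v c, IsWall W v c → inner ℝ v q = c → ¬ inner ℝ v q' ≤ c := by
      intro v c hv heq hle
      have h1 : q + (η / 2) • v ∈ ball q η := by
        rw [mem_ball, dist_eq_norm, add_sub_cancel_left, norm_smul, hv.norm_eq_one, mul_one,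
          Real.norm_of_nonneg (by linarith)]
        linarith
      have h2 := hball h1 v c hv hle
      rw [inner_add_right, inner_smul_right, real_inner_self_eq_norm_sq, hv.norm_eq_one, heq] at h2
      linarith
    intro v c hv heq
    have h1 := key v c hv heq
    exact key _ _ hv.neg (by rw [inner_neg_left, heq]) (by rw [inner_neg_left]; linarith)

/-- The linear part of an affine map that preserves regular points permutes the normals. -/
lemma symm_mem_wallNormals_of_regular (hW : IsEuclideanReflectionGroup W)
    (T : EuclideanSpace ℝ (Fin d) ≃ₗᵢ[ℝ] EuclideanSpace ℝ (Fin d)) (b : EuclideanSpace ℝ (Fin d))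
    (hT : ∀ q, IsRegularPoint W q → IsRegularPoint W (T q + b)) {v : EuclideanSpace ℝ (Fin d)}
    (hv : v ∈ wallNormals W) : T.symm v ∈ wallNormals W := by
  by_contra hn
  obtain ⟨c, hc⟩ := hv
  set n := T.symm v with hndef
  have hn1 : ‖n‖ = 1 := by rw [hndef, LinearIsometryEquiv.norm_map, hc.norm_eq_one]
  have hTn : ∀ x, inner ℝ v (T x + b) = inner ℝ n x + inner ℝ v b := fun x => by
    rw [inner_add_right, hndef, ← T.inner_map_map (T.symm v), T.apply_symm_apply]
  have := hW.finite_wallNormals.to_subtype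
  -- Since `n` is not a normal up to sign, no wall direction contains `n⊥`; finitely many proper
  -- subspaces do not cover `n⊥`.
  obtain ⟨z, hzn, hz⟩ : ∃ z, inner ℝ n z = 0 ∧ ∀ v' ∈ wallNormals W, inner ℝ v' z ≠ 0 := by
    obtain ⟨z, hz, h⟩ := Module.Dual.exists_forall_mem_ne_zero_of_forall_exists (K := ℝ)
      (ι := wallNormals W) (LinearMap.ker (innerSL ℝ n).toLinearMap)
      (fun v' => (innerSL ℝ (v' : EuclideanSpace ℝ (Fin d))).toLinearMap) (by
        rintro ⟨v', hv'⟩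
        refine ⟨v' - (inner ℝ n v') • n, ?_, ?_⟩
        · simp [inner_sub_right, inner_smul_right, hn1]
        · have n' := norm_eq_one_of_mem_wallNormals hv'
          simp only [ContinuousLinearMap.coe_coe, innerSL_apply_apply, inner_sub_right,
            inner_smul_right, real_inner_self_eq_norm_sq, n', real_inner_comm]
          intro h0
          have h1 : inner ℝ n v' = (1 : ℝ) ∨ inner ℝ n v' = (-1 : ℝ) := by
            rw [real_inner_comm] at h0
            rw [← sq_eq_one_iff]
            linarith
          rcases h1 with h1 | h1
          · rw [inner_eq_one_iff_of_norm_eq_one hn1 n'] at h1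
            exact hn (h1 ▸ hv')
          · rw [inner_eq_neg_one_iff_of_norm_eq_one hn1 n'] at h1
            exact hn (h1 ▸ neg_mem_wallNormals hv'))
    exact ⟨z, by simpa using hz, fun v' hv' => by simpa using h ⟨v', hv'⟩⟩
  -- The affine map sends the line `x₀ + s • z` into the wall `(v, c)`, so every point of this line
  -- lies on a wall. As `z` is transverse to all walls, different points need different walls,
  -- against local finiteness.
  set x₀ := (c - inner ℝ v b) • n with hx₀
  have hbad : ∀ s : ℝ, ∃ v' c', IsWall W v' c' ∧ inner ℝ v' (x₀ + s • z) = c' := by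
    intro s
    by_contra! hcon
    refine hT (x₀ + s • z) hcon v c hc ?_
    rw [hTn, inner_add_right, inner_smul_right (r := s), hzn, hx₀, inner_smul_right,
      real_inner_self_eq_norm_sq, hn1]
    ring
  choose v' c' hw hon using hbad
  have hinj : InjOn (fun s => hyperplane (v' s) (c' s)) (Icc (0 : ℝ) 1) := by
    intro s _ s' _ heq
    have h1 : x₀ + s' • z ∈ hyperplane (v' s) (c' s) := by
      rw [show hyperplane (v' s) (c' s) = _ from heq]; exact hon s'
    have h2 := hon s
    rw [hyperplane, mem_ofPred_eq, ← h2, inner_add_right, inner_add_right,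
      inner_smul_right (r := s), inner_smul_right (r := s')] at h1
    have h3 : (s' - s) * inner ℝ (v' s) z = 0 := by linarith
    rcases mul_eq_zero.1 h3 with h4 | h4
    · linarith
    · exact absurd h4 (hz _ ⟨_, hw s⟩)
  refine (Icc_infinite (zero_lt_one (α := ℝ))) ((hW.locallyFinite x₀ ‖z‖).of_injOn ?_ hinj)
  intro s hs
  refine ⟨v' s, c' s, hw s, rfl, x₀ + s • z, hon s, ?_⟩
  rw [mem_closedBall, dist_eq_norm, add_sub_cancel_left, norm_smul, Real.norm_of_nonneg hs.1]
  exact mul_le_of_le_one_left (norm_nonneg _) hs.2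

/-- The inverse of `T` permutes the finite set of normals. The order of this permutation works
because the normals span. -/
lemma exists_pow_eq_one_of_symm_mem_wallNormals (hW : IsEuclideanReflectionGroup W)
    (T : EuclideanSpace ℝ (Fin d) ≃ₗᵢ[ℝ] EuclideanSpace ℝ (Fin d))
    (hT : ∀ v ∈ wallNormals W, T.symm v ∈ wallNormals W) :
    ∃ k > 0, ∀ x, T^[k] x = x := by
  have := hW.finite_wallNormals.to_subtype
  let σ : wallNormals W → wallNormals W := fun v => ⟨T.symm v, hT v v.2⟩
  have hσ : Function.Injective σ := fun a b h =>
    Subtype.ext (T.symm.injective (congrArg Subtype.val h))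
  let π : Equiv.Perm (wallNormals W) := Equiv.ofBijective σ (Finite.injective_iff_bijective.1 hσ)
  have hiter : ∀ (k : ℕ) (v : wallNormals W), (((π ^ k) v : wallNormals W) : EuclideanSpace ℝ (Fin d))
      = (T⁻¹ ^ k) v := by
    intro k
    induction k with
    | zero => simp
    | succ k ih =>
      intro v
      rw [pow_succ, pow_succ, Equiv.Perm.mul_apply, ih]
      rfl
  refine ⟨orderOf π, orderOf_pos π, fun x => ?_⟩
  have h1 : T⁻¹ ^ orderOf π = 1 := hW.linearIsometryEquiv_ext fun v hv => by
    rw [← hiter _ ⟨v, hv⟩, pow_orderOf_eq_one]; rfl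
  have h2 : T ^ orderOf π = 1 := by rw [← inv_inj, ← inv_pow, h1, inv_one]
  have h3 : ∀ k : ℕ, ∀ y, (T ^ k) y = T^[k] y := by
    intro k
    induction k with
    | zero => intro y; rfl
    | succ k ih => intro y; rw [pow_succ, Function.iterate_succ_apply, ← ih]; rfl
  rw [← h3, h2]; rfl

end WallGeometry

/-! ### Apartments, parallel lines and limits of charts. -/

section Apartments

variable {X : Type*} [MetricSpace X] {d : ℕ}
  {W : Subgroup (EuclideanSpace ℝ (Fin d) ≃ᵃⁱ[ℝ] EuclideanSpace ℝ (Fin d))}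
  {charts : Set (EuclideanSpace ℝ (Fin d) → X)}

lemma Isometry.isPointAt_chart {φ : EuclideanSpace ℝ (Fin d) → X} (hφ : Isometry φ)
    (x y : EuclideanSpace ℝ (Fin d)) {l : ℝ} (h : 0 ≤ l) (h' : l ≤ 1) :
    IsPointAt (φ x) (φ y) l (φ (x + l • (y - x))) := by
  refine ⟨h, h', ?_, ?_⟩ <;> rw [hφ.dist_eq, hφ.dist_eq, dist_eq_norm, dist_eq_norm]
  · rw [sub_add_cancel_left, norm_neg, norm_smul, Real.norm_of_nonneg h, norm_sub_rev]
  · rw [show x + l • (y - x) - y = (1 - l) • (x - y) by module, norm_smul,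
      Real.norm_of_nonneg (by linarith)]

lemma IsApartmentSystem.range_comp (hC : IsApartmentSystem W charts)
    {φ : EuclideanSpace ℝ (Fin d) → X} (hφ : φ ∈ charts)
    {w : EuclideanSpace ℝ (Fin d) ≃ᵃⁱ[ℝ] EuclideanSpace ℝ (Fin d)} (hw : w ∈ W) :
    (fun x => φ (w x)) ∈ charts ∧ range (fun x => φ (w x)) = range φ :=
  ⟨hC.comp_mem φ hφ w hw, w.surjective.range_comp φ⟩

/-- A chart whose apartment contains two given points and that agrees with a given chart on the
intersection of the two apartments. -/
lemma IsApartmentSystem.exists_chart (hC : IsApartmentSystem W charts)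
    {φ : EuclideanSpace ℝ (Fin d) → X} (hφ : φ ∈ charts) (x y : X) :
    ∃ ψ ∈ charts, x ∈ range ψ ∧ y ∈ range ψ ∧ ∀ z, φ z ∈ range ψ → φ z = ψ z := by
  obtain ⟨ψ, hψ, hx, hy⟩ := hC.exists_common x y
  obtain ⟨w, hw, h⟩ := hC.exists_iso φ hφ ψ hψ
  obtain ⟨h1, h2⟩ := hC.range_comp hψ hw
  exact ⟨_, h1, by rwa [h2], by rwa [h2], fun z hz => h z (by rwa [h2] at hz)⟩

/-- A segment issuing from `φ e` in a direction close to a Weyl chamber direction of the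
apartment of `φ` stays in that apartment for a while. -/
lemma IsCAT0.exists_mem_range_of_direction (hX : IsCAT0 X) (hW : IsEuclideanReflectionGroup W)
    (hC : IsApartmentSystem W charts) {φ : EuclideanSpace ℝ (Fin d) → X} (hφ : φ ∈ charts)
    {u e z : EuclideanSpace ℝ (Fin d)} (hu : IsRegularDirection W u) {x : X}
    (hr : dist (φ e) x = ‖z - e‖)
    (hz : ∀ q, ‖q - (z - e)‖ ≤ dist x (φ z) → q ∈ weylChamber W u) :
    ∃ θ > 0, θ ≤ 1 ∧ ∀ m, IsPointAt (φ e) x θ m → m ∈ range φ := by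
  obtain ⟨η, hη, hgap⟩ := hW.exists_gap e
  obtain ⟨θ, hθ, hθ1, hθη⟩ : ∃ θ > 0, θ ≤ 1 ∧ θ * ‖z - e‖ < η := by
    have hn := norm_nonneg (z - e)
    refine ⟨min 1 (η / (‖z - e‖ + 1)), by positivity, min_le_left _ _, ?_⟩
    have h1 := min_le_right 1 (η / (‖z - e‖ + 1))
    rw [le_div_iff₀ (by linarith)] at h1
    nlinarith [show 0 < min 1 (η / (‖z - e‖ + 1)) by positivity]
  refine ⟨θ, hθ, hθ1, fun m hm => ?_⟩
  have hφi := hC.isometry φ hφ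
  obtain ⟨ψ, hψ, hP, ⟨x₀, rfl⟩, hag⟩ := hC.exists_chart hφ (φ (e + θ • (z - e))) x
  have hψi := hC.isometry ψ hψ
  have hzC : z - e ∈ weylChamber W u := hz _ (by simp)
  have hcell := hC.subcomplex φ hφ ψ hψ _ hP
  have hmem : ∀ q, ‖q‖ = ‖z - e‖ → q ∈ weylChamber W u → ∀ τ, 0 ≤ τ → τ ≤ θ →
      φ (e + τ • q) ∈ range ψ := by
    intro q hq hqC τ hτ hτθ
    refine hcell (mem_image_of_mem φ (add_smul_mem_closedCell hgap hu hzC hqC hθ hτ hθη ?_))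
    rw [hq]
    exact (mul_le_mul_of_nonneg_right hτθ (norm_nonneg _)).trans_lt hθη
  have he : φ e = ψ e := hag e (by simpa using hmem _ rfl hzC 0 le_rfl hθ.le)
  have hnorm : ‖x₀ - e‖ = ‖z - e‖ := by
    rw [← hr, he, hψi.dist_eq, dist_eq_norm, norm_sub_rev]
  have h1 := hψi.isPointAt_chart e x₀ hθ.le hθ1
  have h2 := hφi.isPointAt_chart e z hθ.le hθ1
  rw [he] at h2
  -- Read in `ψ`, the direction towards `x` differs from `z - e` by at most `dist x (φ z)`. It
  -- therefore lies in the Weyl chamber, and the segment starts in the cell shared by both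
  -- apartments.
  have h3 := hX.dist_le_mul h1 h2
  rw [hag _ hP, hψi.dist_eq, dist_eq_norm, add_sub_add_left_eq_sub, ← smul_sub, norm_smul,
    Real.norm_of_nonneg hθ.le] at h3
  have h4 := le_of_mul_le_mul_left h3 hθ
  have h5 := hmem _ hnorm (hz _ h4) θ hθ.le le_rfl
  rw [he] at hm
  rw [hX.eq_of_isPointAt hm h1, ← hag _ h5]
  exact mem_range_self _

-- Suppose `y = c 0` is outside. On the segment from `y` to a far point `q` of the line, let `φ e`
-- be the apartment point nearest to `y`. By `IsCAT0.excess_le`, `y` is almost between `q` and the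
-- opposite far point `q'`. So the directions at `φ e` towards `y` and towards `q'` almost agree,
-- and the latter is well inside the Weyl chamber of `-u`. The segment towards `y` then stays in the
-- apartment beyond `φ e`, a contradiction.
set_option maxHeartbeats 1000000 in
lemma IsCAT0.mem_range_of_parallel_zero [ProperSpace X] (hX : IsCAT0 X)
    (hW : IsEuclideanReflectionGroup W) (hC : IsApartmentSystem W charts)
    {φ : EuclideanSpace ℝ (Fin d) → X} (hφ : φ ∈ charts) {p u : EuclideanSpace ℝ (Fin d)}
    (hu : IsRegularDirection W u) (hu1 : ‖u‖ = 1) {c : ℝ → X} (hc : Isometry c) {K : ℝ}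
    (hK : ∀ s, dist (φ (p + s • u)) (c s) ≤ K) : c 0 ∈ range φ := by
  by_contra hy
  have hφi := hC.isometry φ hφ
  have hclosed : IsClosed (range φ) := hφi.isClosedEmbedding.isClosed_range
  have hK0 : 0 ≤ K := dist_nonneg.trans (hK 0)
  set y := c 0 with hydef
  set η := infDist y (range φ) with hη
  have hη0 : 0 < η := (hclosed.notMem_iff_infDist_pos (range_nonempty φ)).1 hy
  obtain ⟨ε, hε0, hε1, hε⟩ : ∃ ε > 0, ε ≤ 1 ∧ ∀ v ∈ wallNormals W, ε ≤ |inner ℝ v (-u)| := by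
    obtain ⟨ε, hε0, hε⟩ := hW.exists_pos_le_abs_inner hu
    exact ⟨min ε 1, by positivity, min_le_right _ _, fun v hv => by
      rw [inner_neg_right, abs_neg]; exact (min_le_left _ _).trans (hε v hv)⟩
  obtain ⟨δ, hδ⟩ : ∃ δ, δ = ε ^ 2 * η / 64 := ⟨_, rfl⟩
  have hδ0 : 0 < δ := by rw [hδ]; positivity
  -- The terms serve to make the excess `K ^ 2 / N` at most `δ`, the error `K` at most `N * ε / 4`,
  -- and the distance from `φ e` to `q'` at least `η`.
  obtain ⟨N, hN⟩ : ∃ N, N = 4 * (K / ε) + K + η + K ^ 2 / δ + 1 := ⟨_, rfl⟩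
  have hKε : 0 ≤ K / ε := by positivity
  have hKδ : 0 ≤ K ^ 2 / δ := by positivity
  have hN0 : 0 < N := by linarith
  have hNδ : K ^ 2 / N ≤ δ := by
    rw [div_le_iff₀ hN0]
    have : K ^ 2 / δ ≤ N := by linarith
    rwa [div_le_iff₀ hδ0, mul_comm] at this
  have hNK : 4 * K ≤ N * ε := by
    have : 4 * (K / ε) ≤ N := by linarith
    calc 4 * K = 4 * (K / ε) * ε := by field_simp
      _ ≤ N * ε := by gcongr
  have hline : Isometry fun s : ℝ => φ (p + s • u) := Isometry.of_dist_eq fun s s' => by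
    rw [hφi.dist_eq, dist_eq_norm, add_sub_add_left_eq_sub, ← sub_smul, norm_smul, hu1, mul_one,
      Real.dist_eq, Real.norm_eq_abs]
  have hexc := hX.excess_le hline hc hK hN0
  simp only [← hydef] at hexc
  set q := φ (p + N • u) with hq
  set q' := φ (p + (-N) • u) with hq'
  have hqq' : dist q' q = 2 * N := by
    have := hline.dist_eq (-N) N
    rw [Real.dist_eq, abs_sub_comm, abs_of_pos (by linarith)] at this
    rw [hq, hq', this]; ring
  set S := range φ ∩ {m | dist y m + dist m q = dist y q} with hS
  have hSc : IsCompact S := by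
    refine (isCompact_closedBall y (dist y q)).of_isClosed_subset
      (hclosed.inter (isClosed_eq (by fun_prop) continuous_const)) ?_
    rintro m ⟨-, hm⟩
    rw [mem_ofPred_eq] at hm
    rw [mem_closedBall, dist_comm]
    linarith [dist_nonneg (x := m) (y := q)]
  obtain ⟨_, ⟨⟨e, rfl⟩, heseg⟩, hmin⟩ := hSc.exists_isMinOn (f := fun m => dist y m)
    ⟨q, mem_range_self _, by simp⟩ (by fun_prop)
  rw [mem_ofPred_eq] at heseg
  have hDη : η ≤ dist y (φ e) := infDist_le_dist_of_mem (mem_range_self _)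
  have hD0 : 0 < dist y (φ e) := by linarith
  -- a point at distance `η` from `φ e` towards `y`
  obtain ⟨x, hx⟩ := hX.exists_isPointAt (φ e) y (l := η / dist y (φ e)) (by positivity)
    ((div_le_one hD0).2 hDη)
  have hex : dist (φ e) x = η := by
    rw [hx.2.2.1, dist_comm (φ e)]; field_simp
  have hxy : dist x y = dist y (φ e) - η := by
    rw [hx.2.2.2, dist_comm (φ e)]; field_simp
  -- `φ e` is close to the line
  have hyq : 0 < dist q y := by
    rw [dist_comm q]; linarith [dist_nonneg (x := φ e) (y := q)]
  obtain ⟨a, ha, herr⟩ : ∃ a, N ≤ a ∧ ‖((p + (-N) • u) - e) - a • (-u)‖ ≤ K := by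
    have h1 : IsPointAt q y (dist q (φ e) / dist q y) (φ e) :=
      isPointAt_div hyq rfl (by rw [dist_comm _ y, dist_comm q, dist_comm q]; linarith)
    have h2 := hφi.isPointAt_chart (p + N • u) (p + (0 : ℝ) • u) h1.1 h1.2.1
    have h3 := hX.dist_le_mul h1 h2
    have hl0 := h1.1
    have hl1 := h1.2.1
    set l := dist q (φ e) / dist q y
    refine ⟨N * (2 - l), le_mul_of_one_le_right hN0.le (by linarith), ?_⟩
    rw [hφi.dist_eq, dist_eq_norm, dist_comm y] at h3
    have h4 : l * dist (φ (p + (0 : ℝ) • u)) y ≤ K :=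
      (mul_le_of_le_one_left dist_nonneg hl1).trans (hK 0)
    refine le_trans (le_of_eq ?_) (h3.trans h4)
    rw [← norm_neg]
    congr 1
    module
  have ha0 : 0 < a := by linarith
  have hane : ‖a • (-u)‖ = a := by
    rw [norm_smul, norm_neg, hu1, mul_one, Real.norm_of_nonneg ha0.le]
  set g := (p + (-N) • u) - e with hg
  have hLm : dist (φ e) q' = ‖g‖ := by
    rw [hq', hφi.dist_eq, dist_eq_norm, norm_sub_rev]
  have hgle : ‖g‖ ≤ a + K := by
    have := norm_add_le (g - a • (-u)) (a • (-u))
    rw [sub_add_cancel, hane] at this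
    linarith
  have hgge : a - K ≤ ‖g‖ := by
    have := norm_sub_norm_le (a • (-u)) (a • (-u) - g)
    rw [sub_sub_cancel, hane, norm_sub_rev] at this
    linarith
  have hKa : 4 * K ≤ a * ε := hNK.trans (by gcongr)
  have hgη : η ≤ ‖g‖ := by linarith
  have hg0 : 0 < ‖g‖ := by linarith
  have hl0 : 0 ≤ η / ‖g‖ := by positivity
  have hl1 : η / ‖g‖ ≤ 1 := (div_le_one hg0).2 hgη
  have hl : η / ‖g‖ * ‖g‖ = η := by field_simp
  set z := e + (η / ‖g‖) • g with hz
  have hze : z - e = (η / ‖g‖) • g := by rw [hz, add_sub_cancel_left]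
  have hzpt : IsPointAt (φ e) q' (η / ‖g‖) (φ z) := hφi.isPointAt_chart e _ hl0 hl1
  have hxq' : dist x q' ≤ ‖g‖ + δ - η := by
    have h1 := dist_triangle x y q'
    have h2 := dist_triangle q' (φ e) q
    rw [dist_comm q' (φ e), hLm] at h2
    rw [dist_comm y q'] at h1
    linarith
  have hCN := hX.sq_dist_le x hzpt
  rw [dist_comm x (φ e), hex, hLm] at hCN
  have hδη : δ ≤ 2 * η := by
    rw [hδ]
    have : ε ^ 2 * η ≤ η := mul_le_of_le_one_left hη0.le (pow_le_one₀ hε0.le hε1)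
    linarith
  -- Both `x` and `φ z` are at distance `η` from `φ e`, and `x` lies within `δ` of realizing the
  -- distance from `φ e` to `q'`.
  have hDsq : dist x (φ z) ^ 2 ≤ 2 * η * δ := by
    have h1 : dist x q' ^ 2 ≤ (‖g‖ + δ - η) ^ 2 := by gcongr
    have h2 := mul_le_mul_of_nonneg_left h1 hl0
    have h3 : (1 - η / ‖g‖) * η ^ 2 + η / ‖g‖ * (‖g‖ + δ - η) ^ 2
        - η / ‖g‖ * (1 - η / ‖g‖) * ‖g‖ ^ 2 = 2 * η * δ + η / ‖g‖ * (δ * (δ - 2 * η)) := by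
      field_simp
      ring
    have h4 : η / ‖g‖ * (δ * (δ - 2 * η)) ≤ 0 :=
      mul_nonpos_of_nonneg_of_nonpos hl0 (mul_nonpos_of_nonneg_of_nonpos hδ0.le (by linarith))
    linarith
  have hD : dist x (φ z) < 3 / 8 * (η * ε) := by
    refine lt_of_pow_lt_pow_left₀ 2 (by positivity) (hDsq.trans_lt ?_)
    have h1 : 0 < (η * ε) ^ 2 := by positivity
    have h2 : 2 * η * δ = (η * ε) ^ 2 / 32 := by rw [hδ]; ring
    have h3 : (3 / 8 * (η * ε)) ^ 2 = 9 / 64 * (η * ε) ^ 2 := by ring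
    linarith
  have hratio : 3 / 8 * (η * ε) ≤ η / ‖g‖ * (a * ε - K) := by
    have h1 : 3 / 8 * (η * ε) * ‖g‖ ≤ η * (a * ε - K) := by
      have haε : a * ε ≤ a := mul_le_of_le_one_right ha0.le hε1
      have h2 : ‖g‖ ≤ 2 * a := by linarith
      have h3 : 3 / 8 * (η * ε) * ‖g‖ ≤ 3 / 8 * (η * ε) * (2 * a) := by gcongr
      have h4 : η * (4 * K) ≤ η * (a * ε) := by gcongr
      have h5 : 3 / 8 * (η * ε) * (2 * a) = 3 / 4 * (η * (a * ε)) := by ring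
      have h6 : η * (a * ε - K) = η * (a * ε) - η * (4 * K) / 4 := by ring
      linarith
    rw [div_mul_eq_mul_div η, le_div_iff₀ hg0]
    exact h1
  obtain ⟨θ, hθ0, hθ1, hθ⟩ := hX.exists_mem_range_of_direction hW hC hφ hu.neg (e := e) (z := z)
    (x := x) (by rw [hex, hze, norm_smul, Real.norm_of_nonneg hl0, hl]) (by
      intro v hv
      refine mem_weylChamber_of_norm_sub_lt (a := η / ‖g‖ * a) (by positivity) hε ?_
      have h1 : v - (η / ‖g‖ * a) • (-u) = (v - (z - e)) + (η / ‖g‖) • (g - a • (-u)) := by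
        rw [hze]; module
      rw [h1]
      refine (norm_add_le _ _).trans_lt ?_
      rw [norm_smul, Real.norm_of_nonneg hl0]
      have := mul_le_mul_of_nonneg_left herr hl0
      linarith)
  obtain ⟨m, hm⟩ := hX.exists_isPointAt (φ e) x hθ0.le hθ1
  have hem := hm.2.2.1
  have hmx := hm.2.2.2
  rw [hex] at hem hmx
  have hym : dist y m ≤ dist y (φ e) - θ * η := by
    have := dist_triangle y x m
    rw [dist_comm y x, dist_comm x m] at this
    linarith
  have hmS : m ∈ S := by
    refine ⟨hθ m hm, le_antisymm ?_ (dist_triangle _ _ _)⟩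
    have := dist_triangle m (φ e) q
    rw [dist_comm m (φ e)] at this
    linarith
  have := hmin hmS
  simp only [mem_ofPred_eq] at this
  linarith [mul_pos hθ0 hη0]

/-- A line at bounded distance from a line of an apartment in a regular direction lies in that
apartment. -/
lemma IsCAT0.mem_range_of_parallel [ProperSpace X] (hX : IsCAT0 X)
    (hW : IsEuclideanReflectionGroup W) (hC : IsApartmentSystem W charts)
    {φ : EuclideanSpace ℝ (Fin d) → X} (hφ : φ ∈ charts) {p u : EuclideanSpace ℝ (Fin d)}
    (hu : IsRegularDirection W u) (hu1 : ‖u‖ = 1) {c : ℝ → X} (hc : Isometry c) {K : ℝ}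
    (hK : ∀ s, dist (φ (p + s • u)) (c s) ≤ K) (s : ℝ) : c s ∈ range φ := by
  have := hX.mem_range_of_parallel_zero hW hC hφ (p := p + s • u) hu hu1 (hc.comp_add_right s)
    (K := K) (fun r => by
      have := hK (r + s)
      rwa [add_smul, add_comm (r • u), ← add_assoc] at this)
  simpa using this

/-- A map that agrees with charts on arbitrarily large balls is a chart of the complete apartment
system. -/
lemma mem_charts_of_forall_ball (hW : IsEuclideanReflectionGroup W)
    (hmax : Maximal (IsApartmentSystem W) charts) {ψ : EuclideanSpace ℝ (Fin d) → X}
    (p : EuclideanSpace ℝ (Fin d))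
    (h : ∀ n : ℕ, ∃ φ ∈ charts, ∀ y, dist y p ≤ n → ψ y = φ y) : ψ ∈ charts := by
  have hC := hmax.prop
  choose φ hφ hag using h
  have hagev : ∀ y, ∃ N : ℕ, ∀ n ≥ N, ψ y = φ n y := fun y => by
    obtain ⟨N, hN⟩ := exists_nat_ge (dist y p)
    exact ⟨N, fun n hn => hag n y (hN.trans (by exact_mod_cast hn))⟩
  have hag2 : ∀ x y, ∃ n, ψ x = φ n x ∧ ψ y = φ n y := fun x y => by
    obtain ⟨N, hN⟩ := hagev x
    obtain ⟨M, hM⟩ := hagev y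
    exact ⟨max N M, hN _ (le_max_left _ _), hM _ (le_max_right _ _)⟩
  have hψi : Isometry ψ := Isometry.of_dist_eq fun x y => by
    obtain ⟨n, hx, hy⟩ := hag2 x y
    rw [hx, hy, (hC.isometry _ (hφ n)).dist_eq]
  have hrange : ∀ w : EuclideanSpace ℝ (Fin d) ≃ᵃⁱ[ℝ] EuclideanSpace ℝ (Fin d),
      range (fun x => ψ (w x)) = range ψ := fun w => w.surjective.range_comp ψ
  have hsub1 : ∀ χ ∈ charts, ∀ x, χ x ∈ range ψ → χ '' closedCell W x ⊆ range ψ := by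
    rintro χ hχ x ⟨y, hy⟩ _ ⟨x', hx', rfl⟩
    obtain ⟨n, hn⟩ := exists_nat_ge (dist x' x + dist y p)
    have hyn : ψ y = φ n y := hag n y (by linarith [dist_nonneg (x := x') (y := x)])
    obtain ⟨y', hy'⟩ := hC.subcomplex χ hχ _ (hφ n) x ⟨y, by rw [← hyn, hy]⟩
      (mem_image_of_mem χ hx')
    refine ⟨y', ?_⟩
    rw [hag n y' ?_, hy']
    have h1 : dist y' y = dist x' x := by
      rw [← (hC.isometry _ (hφ n)).dist_eq, hy', ← hyn, hy, (hC.isometry _ hχ).dist_eq]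
    linarith [dist_triangle y' y p]
  have hsub2 : ∀ χ ∈ charts, ∀ w ∈ W, ∀ x, ψ (w x) ∈ range χ →
      (fun x => ψ (w x)) '' closedCell W x ⊆ range χ := by
    rintro χ hχ w hw x hx _ ⟨x', hx', rfl⟩
    obtain ⟨n, hn, hn'⟩ := hag2 (w x) (w x')
    rw [hn] at hx
    have := hC.subcomplex _ (hC.comp_mem _ (hφ n) w hw) χ hχ x hx (mem_image_of_mem _ hx')
    simp only at this ⊢
    rwa [hn']
  -- Once one common point is fixed, the isomorphisms from `χ` to `φ n` take finitely many values
  -- for almost all `n`; the ultrafilter selects one that works for all common points.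
  have hiso : ∀ χ ∈ charts, ∃ w ∈ W, ∀ x, χ x ∈ range ψ → χ x = ψ (w x) := by
    intro χ hχ
    by_cases hne : ∃ x y, ψ y = χ x
    swap
    · exact ⟨1, W.one_mem, fun x ⟨y, hy⟩ => (hne ⟨x, y, hy⟩).elim⟩
    obtain ⟨x₀, y₀, h₀⟩ := hne
    choose w hwW hw using fun n => hC.exists_iso χ hχ _ (hφ n)
    have hev : ∀ x y, ψ y = χ x → ∀ᶠ n in (hyperfilter ℕ : Filter ℕ), w n x = y := by
      intro x y hxy
      obtain ⟨N, hN⟩ := hagev y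
      refine Nat.hyperfilter_le_atTop ?_
      filter_upwards [eventually_ge_atTop N] with n hn
      have h1 : φ n y = χ x := by rw [← hN n hn, hxy]
      exact (hC.isometry _ (hφ n)).injective (by rw [h1, ← hw n x ⟨y, h1⟩])
    obtain ⟨g, ⟨hg, -⟩, hgev⟩ := (hyperfilter ℕ).exists_eventually_eq
      (hW.finite_transporter x₀ y₀) (f := w) (by
        filter_upwards [hev x₀ y₀ h₀] with n hn
        exact ⟨hwW n, hn⟩)
    refine ⟨g, hg, ?_⟩
    rintro x ⟨y, hy⟩
    obtain ⟨n, hn, hn'⟩ := (hgev.and (hev x y hy)).exists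
    rw [← hy, ← hn', hn]
  -- Adjoining `ψ` and its translates by `W` gives an apartment system again, so maximality puts `ψ`
  -- in `charts`.
  have hsys : IsApartmentSystem W (charts ∪ {χ | ∃ w ∈ W, χ = fun x => ψ (w x)}) := by
    refine ⟨?_, ?_, ?_, ?_, ?_⟩
    · rintro χ (hχ | ⟨w, hw, rfl⟩)
      · exact hC.isometry χ hχ
      · exact hψi.comp w.isometry
    · rintro χ (hχ | ⟨w, hw, rfl⟩) g hg
      · exact Or.inl (hC.comp_mem χ hχ g hg)
      · exact Or.inr ⟨w * g, W.mul_mem hw hg, rfl⟩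
    · rintro χ (hχ | ⟨w, hw, rfl⟩) χ' (hχ' | ⟨w', hw', rfl⟩) x hx
      · exact hC.subcomplex χ hχ χ' hχ' x hx
      · rw [hrange] at hx ⊢
        exact hsub1 χ hχ x hx
      · exact hsub2 χ' hχ' w hw x hx
      · rw [hrange]
        rintro _ ⟨x', -, rfl⟩
        exact mem_range_self _
    · intro x y
      obtain ⟨χ, hχ, hx, hy⟩ := hC.exists_common x y
      exact ⟨χ, Or.inl hχ, hx, hy⟩
    · rintro χ (hχ | ⟨w, hw, rfl⟩) χ' (hχ' | ⟨w', hw', rfl⟩)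
      · exact hC.exists_iso χ hχ χ' hχ'
      · obtain ⟨g, hg, h⟩ := hiso χ hχ
        refine ⟨w'⁻¹ * g, W.mul_mem (W.inv_mem hw') hg, fun x hx => ?_⟩
        rw [hrange] at hx
        simp [AffineIsometryEquiv.coe_mul, AffineIsometryEquiv.coe_inv, ← h x hx]
      · obtain ⟨g, hg, h⟩ := hiso χ' hχ'
        refine ⟨g⁻¹ * w, W.mul_mem (W.inv_mem hg) hw, ?_⟩
        rintro x ⟨z, hz⟩
        simp only at hz ⊢
        have h1 := h z ⟨_, hz.symm⟩
        have h2 : w x = g z := hψi.injective (by rw [← h1, hz])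
        rw [← hz]
        simp [AffineIsometryEquiv.coe_mul, AffineIsometryEquiv.coe_inv, h2]
      · refine ⟨w'⁻¹ * w, W.mul_mem (W.inv_mem hw') hw, fun x _ => ?_⟩
        simp [AffineIsometryEquiv.coe_mul, AffineIsometryEquiv.coe_inv]
  exact hmax.le_of_ge hsys subset_union_left (Or.inr ⟨1, W.one_mem, rfl⟩)

/-- A geodesic between two points of an apartment is a straight segment of it. -/
lemma IsCAT0.exists_eq_chart_segment (hX : IsCAT0 X) {ψ : EuclideanSpace ℝ (Fin d) → X}
    (hψ : Isometry ψ) {c : ℝ → X} (hc : Isometry c) {N : ℝ} (hN : 0 < N)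
    (h₁ : c (-N) ∈ range ψ) (h₂ : c N ∈ range ψ) :
    ∃ q u, ∀ s ∈ Icc (-N) N, c s = ψ (q + s • u) := by
  obtain ⟨x₁, hx₁⟩ := h₁
  obtain ⟨x₂, hx₂⟩ := h₂
  refine ⟨(1 / 2 : ℝ) • (x₁ + x₂), (1 / (2 * N)) • (x₂ - x₁), fun s hs => ?_⟩
  have hl0 : 0 ≤ (s + N) / (2 * N) := div_nonneg (by linarith [hs.1]) (by linarith)
  have hl1 : (s + N) / (2 * N) ≤ 1 := (div_le_one (by linarith)).2 (by linarith [hs.2])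
  have h1 := hc.isPointAt (show -N ≤ N by linarith) hl0 hl1
  have h2 := hψ.isPointAt_chart x₁ x₂ hl0 hl1
  rw [hx₁, hx₂] at h2
  have h3 := hX.eq_of_isPointAt h1 h2
  rw [show -N + (s + N) / (2 * N) * (N - -N) = s by field_simp; ring] at h3
  rw [h3]
  congr 1
  rw [smul_smul, show (s + N) / (2 * N) = 1 / 2 + s * (1 / (2 * N)) by field_simp; ring]
  module

/-- The part of an apartment that lies in another one is closed, convex and a union of cells. -/
lemma IsCAT0.chart_preimage_range (hX : IsCAT0 X) (hC : IsApartmentSystem W charts)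
    {φ ψ : EuclideanSpace ℝ (Fin d) → X} (hφ : φ ∈ charts) (hψ : ψ ∈ charts) :
    Convex ℝ (φ ⁻¹' range ψ) ∧ IsClosed (φ ⁻¹' range ψ) ∧
      ∀ x ∈ φ ⁻¹' range ψ, closedCell W x ⊆ φ ⁻¹' range ψ := by
  have hφi := hC.isometry φ hφ
  have hψi := hC.isometry ψ hψ
  refine ⟨?_, hψi.isClosedEmbedding.isClosed_range.preimage hφi.continuous,
    fun x hx y hy => hC.subcomplex φ hφ ψ hψ x hx (mem_image_of_mem φ hy)⟩
  rw [convex_iff_add_mem]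
  rintro x ⟨x', hx⟩ y ⟨y', hy⟩ a b ha hb hab
  have h1 := hφi.isPointAt_chart x y hb (by linarith)
  have h2 := hψi.isPointAt_chart x' y' hb (by linarith)
  rw [hx, hy] at h2
  refine ⟨x' + b • (y' - x'), ?_⟩
  rw [← hX.eq_of_isPointAt h1 h2]
  congr 1
  rw [← eq_sub_iff_add_eq] at hab
  rw [hab]; module

/-- A line that runs in an apartment in a regular direction for a while lies in an apartment. -/
lemma IsCAT0.exists_chart_of_line (hX : IsCAT0 X) (hW : IsEuclideanReflectionGroup W)
    (hmax : Maximal (IsApartmentSystem W) charts) {φ : EuclideanSpace ℝ (Fin d) → X}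
    (hφ : φ ∈ charts) {p u : EuclideanSpace ℝ (Fin d)} (hu : IsRegularDirection W u)
    {c : ℝ → X} (hc : Isometry c) {a b : ℝ} (hab : a < b)
    (hcφ : ∀ s ∈ Icc a b, c s = φ (p + s • u)) :
    ∃ ψ ∈ charts, ∀ s, c s = ψ (p + s • u) := by
  have hC := hmax.prop
  obtain ⟨N₀, hN₀⟩ := exists_nat_ge (max |a| |b|)
  have hψ : ∀ n : ℕ, ∃ ψ ∈ charts, ∀ s ∈ Icc (-(n + N₀ + 1 : ℝ)) (n + N₀ + 1),
      c s = ψ (p + s • u) := by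
    intro n
    obtain ⟨N, hN⟩ : ∃ N : ℝ, N = n + N₀ + 1 := ⟨_, rfl⟩
    rw [← hN]
    have hn0 : (0 : ℝ) ≤ n := n.cast_nonneg
    have ha := abs_le.1 ((le_max_left _ _).trans hN₀)
    have hb := abs_le.1 ((le_max_right _ _).trans hN₀)
    obtain ⟨ψ, hψ, h1, h2, hag⟩ := hC.exists_chart hφ (c (-N)) (c N)
    have hψi := hC.isometry ψ hψ
    obtain ⟨q, u', hq⟩ := hX.exists_eq_chart_segment hψi hc (by linarith) h1 h2
    have hon : ∀ s ∈ Icc a b, p + s • u = q + s • u' := by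
      intro s hs
      have h3 := hq s ⟨by linarith [hs.1], by linarith [hs.2]⟩
      have h4 := hcφ s hs
      exact hψi.injective (by rw [← hag _ ⟨_, by rw [← h3, h4]⟩, ← h4, h3])
    have ea := hon a ⟨le_rfl, hab.le⟩
    have eb := hon b ⟨hab.le, le_rfl⟩
    have huu : u = u' := by
      have : (b - a) • u = (b - a) • u' := by
        have : (p + b • u) - (p + a • u) = (q + b • u') - (q + a • u') := by rw [ea, eb]
        rw [add_sub_add_left_eq_sub, add_sub_add_left_eq_sub] at this
        rwa [sub_smul, sub_smul]
      exact smul_right_injective _ (sub_ne_zero.2 hab.ne') this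
    subst huu
    have hpq : p = q := add_right_cancel ea
    subst hpq
    exact ⟨ψ, hψ, hq⟩
  choose ψ hψ hψc using hψ
  have hψi := fun n => hC.isometry _ (hψ n)
  obtain ⟨ε, hε0, hε⟩ := hW.exists_pos_le_abs_inner hu
  have hψp : ∀ n, ψ n p = c 0 := fun n => by
    have := hψc n 0 ⟨by linarith [n.cast_nonneg (α := ℝ), N₀.cast_nonneg (α := ℝ)], by positivity⟩
    simpa using this.symm
  choose w hwW hw using fun n m => hC.exists_iso _ (hψ n) _ (hψ m)
  have hwp : ∀ n m, w n m p = p := fun n m =>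
    (hψi m).injective (by rw [← hw n m p ⟨p, by rw [hψp, hψp]⟩, hψp, hψp])
  have hlim : ∀ n, ∃ g, (g ∈ W ∧ g p = p) ∧ ∀ᶠ m in (hyperfilter ℕ : Filter ℕ), w n m = g :=
    fun n => (hyperfilter ℕ).exists_eventually_eq (hW.finite_transporter p p)
      (.of_forall fun m => ⟨hwW n m, hwp n m⟩)
  choose g hg hgev using hlim
  -- The apartments of `ψ n` and `ψ m` share a long regular segment centred at `p`, hence a ball of
  -- radius `n * ε`. On it they differ by the limiting transition `g n`.
  have hball : ∀ n : ℕ, ∀ y, dist y p < n * ε →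
      ∀ᶠ m in (hyperfilter ℕ : Filter ℕ), ψ m y = ψ n ((g n)⁻¹ y) := by
    intro n y hy
    filter_upwards [hgev n, Nat.hyperfilter_le_atTop (eventually_ge_atTop n)] with m hm hnm
    have hn0 : (0 : ℝ) < n := by
      by_contra! hcon
      have := mul_nonpos_of_nonpos_of_nonneg hcon hε0.le
      linarith [dist_nonneg (x := y) (y := p)]
    have hnm' : (n : ℝ) ≤ m := by exact_mod_cast hnm
    have hN0 := N₀.cast_nonneg (α := ℝ)
    have hinv : (g n)⁻¹ p = p := by
      conv_lhs => rw [← (hg n).2]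
      simp [AffineIsometryEquiv.coe_inv]
    have hinv' : g n ((g n)⁻¹ y) = y := by simp [AffineIsometryEquiv.coe_inv]
    obtain ⟨k1, k2, k3⟩ := hX.chart_preimage_range hC (hψ n) (hψ m)
    have hseg : ∀ s ∈ Icc (-(n : ℝ)) n, p + s • u ∈ ψ n ⁻¹' range (ψ m) := fun s hs =>
      ⟨p + s • u, by
        rw [← hψc n s ⟨by linarith [hs.1], by linarith [hs.2]⟩,
          ← hψc m s ⟨by linarith [hs.1], by linarith [hs.2]⟩]⟩
    have hin := mem_of_convex_of_closedCell_subset hW k1 k2 k3 hu hε hn0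
      (hseg n ⟨by linarith, le_rfl⟩)
      (by have := hseg (-n) ⟨le_rfl, by linarith⟩; rwa [neg_smul, ← sub_eq_add_neg] at this)
      (y := (g n)⁻¹ y) (by
        rw [← dist_eq_norm]
        conv_lhs => rw [← hinv]
        rwa [((g n)⁻¹).isometry.dist_eq])
    rw [hw n m _ hin, hm, hinv']
  have hex : ∀ y, ∃ n : ℕ, dist y p < n * ε := fun y => by
    obtain ⟨n, hn⟩ := exists_nat_gt (dist y p / ε)
    exact ⟨n, (div_lt_iff₀ hε0).1 hn⟩
  choose k hk using hex
  -- The ultralimit of the charts `ψ m`; by `hball` it is eventually constant at each point.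
  set Ψ : EuclideanSpace ℝ (Fin d) → X := fun y => ψ (k y) ((g (k y))⁻¹ y) with hΨ
  have hΨev : ∀ y, ∀ᶠ m in (hyperfilter ℕ : Filter ℕ), ψ m y = Ψ y := fun y => hball _ y (hk y)
  refine ⟨Ψ, mem_charts_of_forall_ball hW hmax p fun n => ?_, fun s => ?_⟩
  · obtain ⟨m, hm⟩ := exists_nat_gt (n / ε)
    rw [div_lt_iff₀ hε0] at hm
    refine ⟨_, hC.comp_mem _ (hψ m) _ (W.inv_mem (hg m).1), fun y hy => ?_⟩
    obtain ⟨j, h1, h2⟩ := ((hΨev y).and (hball m y (hy.trans_lt hm))).exists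
    rw [← h1, h2]
  · obtain ⟨M, hM⟩ := exists_nat_ge |s|
    obtain ⟨m, h1, h2⟩ := ((hΨev (p + s • u)).and
      (Nat.hyperfilter_le_atTop (eventually_ge_atTop M))).exists
    rw [← h1]
    have h3 := abs_le.1 hM
    have h4 : (M : ℝ) ≤ m := by exact_mod_cast h2
    have hN0 := N₀.cast_nonneg (α := ℝ)
    exact hψc m s ⟨by linarith, by linarith⟩

end Apartments

/-! ### Strongly regular lines and automorphisms. -/

section StronglyRegular

variable {X : Type*} [MetricSpace X]

lemma Isometry.exists_eq_add_smul {d : ℕ} {q : ℝ → EuclideanSpace ℝ (Fin d)} (hq : Isometry q) :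
    ∃ p u, ‖u‖ = 1 ∧ ∀ s, q s = p + s • u := by
  refine ⟨q 0, hq.affineIsometryOfStrictConvexSpace.linearIsometry 1, ?_, fun s => ?_⟩
  · rw [LinearIsometry.norm_map, norm_one]
  · have := hq.affineIsometryOfStrictConvexSpace.map_vadd 0 s
    rw [vadd_eq_add, vadd_eq_add, add_zero] at this
    simp only [Isometry.affineIsometryOfStrictConvexSpace_apply] at this
    rw [this, add_comm, ← map_smul, smul_eq_mul, mul_one]

lemma Isometry.exists_eq_chart_line {d : ℕ} {φ : EuclideanSpace ℝ (Fin d) → X} (hφ : Isometry φ)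
    {c : ℝ → X} (hc : Isometry c) (h : ∀ s, c s ∈ range φ) :
    ∃ p u, ‖u‖ = 1 ∧ ∀ s, c s = φ (p + s • u) := by
  choose q hq using h
  have hqi : Isometry q := Isometry.of_dist_eq fun s t => by
    rw [← hφ.dist_eq, hq, hq, hc.dist_eq]
  obtain ⟨p, u, hu, h⟩ := hqi.exists_eq_add_smul
  exact ⟨p, u, hu, fun s => by rw [← h, hq]⟩

lemma eq_zero_of_forall_mul_le {a K : ℝ} (ha : 0 ≤ a) (h : ∀ s : ℝ, 0 ≤ s → s * a ≤ K) : a = 0 := by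
  by_contra hne
  have hpos : 0 < a := lt_of_le_of_ne ha (Ne.symm hne)
  have h1 := h ((|K| + 1) / a) (by positivity)
  rw [div_mul_cancel₀ _ hne] at h1
  linarith [le_abs_self K]

lemma eq_of_forall_dist_ray_le {d : ℕ} {p q u v : EuclideanSpace ℝ (Fin d)} {K : ℝ}
    (h : ∀ s : ℝ, 0 ≤ s → dist (p + s • u) (q + s • v) ≤ K) : u = v := by
  rw [← sub_eq_zero, ← norm_eq_zero]
  refine eq_zero_of_forall_mul_le (norm_nonneg _) (K := K + ‖p - q‖) fun s hs => ?_
  have h1 := h s hs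
  rw [dist_eq_norm] at h1
  have h2 : s • (u - v) = (p + s • u - (q + s • v)) - (p - q) := by module
  calc s * ‖u - v‖ = ‖s • (u - v)‖ := by rw [norm_smul, Real.norm_of_nonneg hs]
    _ ≤ ‖p + s • u - (q + s • v)‖ + ‖p - q‖ := by rw [h2]; exact norm_sub_le _ _
    _ ≤ K + ‖p - q‖ := by gcongr

/-- A strongly regular line lies in an apartment and has a regular direction there. -/
lemma EuclideanBuilding.IsStronglyRegularLine.exists_chart [ProperSpace X] (hX : IsCAT0 X)
    {Δ : EuclideanBuilding X} {ρ : ℝ → X} {hρ : Isometry ρ} (h : Δ.IsStronglyRegularLine ρ hρ) :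
    ∃ φ ∈ Δ.charts, ∃ p u, IsRegularDirection Δ.W u ∧ ‖u‖ = 1 ∧ ∀ s, ρ s = φ (p + s • u) := by
  obtain ⟨_, _, ⟨φ, hφ, u₀, hu₀, rfl, rfl⟩, ⟨r, x, u, hu1, hu, hr, he⟩, ⟨r', x', u', hu1', hu', hr',
    he'⟩⟩ := h
  have hC := Δ.complete.prop
  have hφi := hC.isometry φ hφ
  obtain ⟨K, hK⟩ := Quotient.exact he
  obtain ⟨K', hK'⟩ := Quotient.exact he'
  have hKs : ∀ s : ℝ, 0 ≤ s → dist (φ (x + s • u)) (ρ s) ≤ K := fun s hs =>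
    (congrArg (fun y => dist y (ρ s)) (hr ⟨s, hs⟩)).ge.trans (hK ⟨s, hs⟩)
  have hKs' : ∀ s : ℝ, 0 ≤ s → dist (φ (x' + s • u')) (ρ (-s)) ≤ K' := fun s hs =>
    (congrArg (fun y => dist y (ρ (-s))) (hr' ⟨s, hs⟩)).ge.trans (hK' ⟨s, hs⟩)
  -- `ρ s` and `ρ (-s)` are `2 * s` apart, which forces the unit vectors `u` and `u'` to be at
  -- distance `2`.
  have huu : u' = -u := by
    have h0 : 2 - ‖u - u'‖ = 0 := by
      refine eq_zero_of_forall_mul_le ?_ (K := K + K' + ‖x - x'‖) fun s hs => ?_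
      · have := norm_sub_le u u'
        rw [hu1, hu1'] at this
        linarith
      · have h1 := dist_triangle4 (ρ s) (φ (x + s • u)) (φ (x' + s • u')) (ρ (-s))
        rw [hρ.dist_eq, Real.dist_eq, sub_neg_eq_add, abs_of_nonneg (by linarith), dist_comm (ρ s),
          hφi.dist_eq, dist_eq_norm] at h1
        have h2 : ‖x + s • u - (x' + s • u')‖ ≤ ‖x - x'‖ + s * ‖u - u'‖ := by
          rw [show x + s • u - (x' + s • u') = (x - x') + s • (u - u') by module]
          refine (norm_add_le _ _).trans ?_
          rw [norm_smul, Real.norm_of_nonneg hs]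
        have h3 := hKs s hs
        have h4 := hKs' s hs
        linarith
    have h1 := @norm_sub_sq_real _ _ _ u u'
    rw [hu1, hu1', show ‖u - u'‖ = 2 by linarith] at h1
    have h2 : inner ℝ u u' = (-1 : ℝ) := by linarith
    rw [inner_eq_neg_one_iff_of_norm_eq_one hu1 hu1'] at h2
    rw [h2, neg_neg]
  subst huu
  have hreg := isRegularDirection_of_mem_weylChamber hu₀ hu
  have hall : ∀ s, dist (φ (x + s • u)) (ρ s) ≤ max K (‖x - x'‖ + K') := by
    intro s
    rcases le_total 0 s with hs | hs
    · exact (hKs s hs).trans (le_max_left _ _)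
    · refine le_trans ?_ (le_max_right _ _)
      have h1 := hKs' (-s) (by linarith)
      rw [neg_neg, smul_neg, neg_smul, neg_neg] at h1
      refine (dist_triangle _ (φ (x' + s • u)) _).trans (add_le_add (le_of_eq ?_) h1)
      rw [hφi.dist_eq, dist_eq_norm, add_sub_add_right_eq_sub]
  obtain ⟨p, v, hv1, hv⟩ := hφi.exists_eq_chart_line hρ
    (hX.mem_range_of_parallel Δ.reflectionGroup hC hφ hreg hu1 hρ hall)
  have huv : u = v := eq_of_forall_dist_ray_le fun s _ => by
    rw [← hφi.dist_eq, ← hv]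
    exact hall s
  subst huv
  exact ⟨φ, hφ, p, u, hreg, hu1, hv⟩

lemma EuclideanBuilding.IsAutomorphism.pow {Δ : EuclideanBuilding X} {h : X ≃ᵢ X}
    (hh : Δ.IsAutomorphism h) (k : ℕ) : Δ.IsAutomorphism (h ^ k) := by
  induction k with
  | zero => intro C; simp
  | succ k ih =>
    intro C
    rw [pow_succ, IsometryEquiv.coe_mul, image_comp, ih, hh]

/-- An automorphism that preserves an apartment preserves the regular points of it. -/
lemma isRegularPoint_of_isAutomorphism {Δ : EuclideanBuilding X} {h : X ≃ᵢ X}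
    (hh : Δ.IsAutomorphism h) {ψ : EuclideanSpace ℝ (Fin Δ.dim) → X} (hψ : ψ ∈ Δ.charts)
    {τ : EuclideanSpace ℝ (Fin Δ.dim) → EuclideanSpace ℝ (Fin Δ.dim)}
    (hτ : ∀ y, ψ (τ y) = h (ψ y)) (hτs : Function.Surjective τ)
    {q : EuclideanSpace ℝ (Fin Δ.dim)} (hq : IsRegularPoint Δ.W q) :
    IsRegularPoint Δ.W (τ q) := by
  have hC := Δ.complete.prop
  have hψi := hC.isometry ψ hψ
  have hτi : Isometry τ := Isometry.of_dist_eq fun x y => by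
    rw [← hψi.dist_eq, hτ, hτ, h.isometry.dist_eq, hψi.dist_eq]
  obtain ⟨χ, hχ, q', hq', himg⟩ := (hh (ψ '' closedCell Δ.W q)).2 ⟨ψ, hψ, q, hq, rfl⟩
  obtain ⟨w, hw, hag⟩ := hC.exists_iso χ hχ ψ hψ
  obtain ⟨η, hη, hball⟩ := hq.exists_ball_subset_closedCell Δ.reflectionGroup
  obtain ⟨q₁, hq₁⟩ := w.surjective (τ q)
  rw [← hq₁]
  refine isRegularPoint_map ((isRegularPoint_iff Δ.reflectionGroup).2 ⟨q', hq', η, hη, ?_⟩) hw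
  intro x hx
  obtain ⟨y, hy⟩ := hτs (w x)
  have hyb : y ∈ ball q η := by
    rw [mem_ball, ← hτi.dist_eq, hy, ← hq₁, w.isometry.dist_eq]
    exact hx
  have h1 : h (ψ y) ∈ χ '' closedCell Δ.W q' := by
    rw [← himg]
    exact mem_image_of_mem h (mem_image_of_mem ψ (hball hyb))
  obtain ⟨x', hx', hxx⟩ := h1
  have h2 := hag x' ⟨τ y, by rw [hτ, hxx]⟩
  rw [hxx, ← hτ, hy] at h2
  rwa [w.injective (hψi.injective h2)]

/-- Some power of an automorphism translating a regular line of an apartment translates the whole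
apartment. -/
lemma IsCAT0.exists_pow_translation [ProperSpace X] (hX : IsCAT0 X) {Δ : EuclideanBuilding X}
    {h : X ≃ᵢ X} (hh : Δ.IsAutomorphism h) {ψ : EuclideanSpace ℝ (Fin Δ.dim) → X}
    (hψ : ψ ∈ Δ.charts) {p u : EuclideanSpace ℝ (Fin Δ.dim)} (hu : IsRegularDirection Δ.W u)
    (hu1 : ‖u‖ = 1) {l : ℝ} (hl : ∀ s : ℝ, h (ψ (p + s • u)) = ψ (p + (s + l) • u)) :
    ∃ k : ℕ, 0 < k ∧ ∀ y, (h ^ k) (ψ y) = ψ (y + (k * l) • u) := by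
  have hC := Δ.complete.prop
  have hψi := hC.isometry ψ hψ
  -- The line through `ψ y` parallel to the axis is mapped to a line parallel to the axis, which
  -- lies in the apartment by rigidity.
  have hmem : ∀ y, h (ψ y) ∈ range ψ := by
    intro y
    have hline : Isometry fun s : ℝ => h (ψ (y + s • u)) := Isometry.of_dist_eq fun s s' => by
      rw [h.isometry.dist_eq, hψi.dist_eq, dist_eq_norm, add_sub_add_left_eq_sub, ← sub_smul,
        norm_smul, hu1, mul_one, Real.dist_eq, Real.norm_eq_abs]
    have := hX.mem_range_of_parallel Δ.reflectionGroup hC hψ (p := p) hu hu1 hline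
      (K := |l| + dist p y) (fun s => by
        refine (dist_triangle _ (h (ψ (p + s • u))) _).trans (add_le_add (le_of_eq ?_)
          (le_of_eq ?_))
        · rw [hl, hψi.dist_eq, dist_eq_norm, add_sub_add_left_eq_sub, ← sub_smul, norm_smul, hu1,
            mul_one, sub_add_cancel_left, norm_neg, Real.norm_eq_abs]
        · rw [h.isometry.dist_eq, hψi.dist_eq, dist_add_right]) 0
    simpa using this
  choose τ hτ using hmem
  have hτi : Isometry τ := Isometry.of_dist_eq fun x y => by
    rw [← hψi.dist_eq, hτ, hτ, h.isometry.dist_eq, hψi.dist_eq]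
  set T := hτi.affineIsometryOfStrictConvexSpace.linearIsometry.toLinearIsometryEquiv rfl with hT
  have hTadd : ∀ x z, τ (x + z) = τ x + T z := fun x z => by
    have := hτi.affineIsometryOfStrictConvexSpace.map_vadd x z
    rw [vadd_eq_add, vadd_eq_add, add_comm z] at this
    rw [add_comm (τ x)]
    exact this
  have hτs : Function.Surjective τ := fun y => ⟨T.symm (y - τ 0), by
    have := hTadd 0 (T.symm (y - τ 0))
    rwa [zero_add, T.apply_symm_apply, add_sub_cancel] at this⟩
  have hτline : ∀ s : ℝ, τ (p + s • u) = p + (s + l) • u := fun s =>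
    hψi.injective (by rw [hτ, hl])
  have hτp : τ p = p + l • u := by simpa using hτline 0
  have hTu : T u = u := by
    have := hτline 1
    rw [one_smul, hTadd, hτp] at this
    have h2 : p + (1 + l) • u = p + l • u + u := by module
    rw [h2] at this
    exact add_left_cancel this
  obtain ⟨k, hk, hTk⟩ := exists_pow_eq_one_of_symm_mem_wallNormals Δ.reflectionGroup T fun v hv =>
    symm_mem_wallNormals_of_regular Δ.reflectionGroup T (τ 0) (fun q hq => by
      have := isRegularPoint_of_isAutomorphism hh hψ hτ hτs hq
      have h2 := hTadd 0 q
      rw [zero_add, add_comm] at h2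
      rwa [← h2]) hv
  -- Around `p` the map is `T` followed by translation by `l • u`. The two commute because `T` fixes
  -- `u`.
  have hiter : ∀ (j : ℕ) z, (h ^ j) (ψ (p + z)) = ψ (p + ((j * l) • u + T^[j] z)) := by
    intro j
    induction j with
    | zero => intro z; simp
    | succ j ih =>
      intro z
      rw [pow_succ', IsometryEquiv.mul_apply, ih, ← hτ, hTadd, hτp, map_add, map_smul, hTu,
        Function.iterate_succ_apply']
      congr 1
      push_cast
      module
  refine ⟨k, hk, fun y => ?_⟩
  have := hiter k (y - p)
  rw [hTk, add_sub_cancel] at this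
  rw [this]
  congr 1
  module

/-- An apartment is a maximal flat: a larger flat would contain a line outside the apartment that
is parallel to a regular line of it. -/
lemma IsCAT0.isMaximalFlat_range [ProperSpace X] (hX : IsCAT0 X) {Δ : EuclideanBuilding X}
    {ψ : EuclideanSpace ℝ (Fin Δ.dim) → X} (hψ : ψ ∈ Δ.charts)
    {u : EuclideanSpace ℝ (Fin Δ.dim)} (hu : IsRegularDirection Δ.W u) (hu1 : ‖u‖ = 1) :
    IsMaximalFlat (range ψ) := by
  have hC := Δ.complete.prop
  have hψi := hC.isometry ψ hψ
  refine ⟨⟨_, ψ, hψi, rfl⟩, ?_⟩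
  rintro _ ⟨n, χ, hχ, rfl⟩ hsub _ ⟨z, rfl⟩
  have hline : Isometry fun s : ℝ => ψ (s • u) := Isometry.of_dist_eq fun s s' => by
    rw [hψi.dist_eq, dist_eq_norm, ← sub_smul, norm_smul, hu1, mul_one, Real.dist_eq,
      Real.norm_eq_abs]
  obtain ⟨q, v, hv1, hv⟩ := hχ.exists_eq_chart_line hline fun s => hsub (mem_range_self _)
  have hline' : Isometry fun s : ℝ => χ (z + s • v) := Isometry.of_dist_eq fun s s' => by
    rw [hχ.dist_eq, dist_eq_norm, add_sub_add_left_eq_sub, ← sub_smul, norm_smul, hv1, mul_one,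
      Real.dist_eq, Real.norm_eq_abs]
  have := hX.mem_range_of_parallel Δ.reflectionGroup hC hψ (p := 0) hu hu1 hline'
    (K := dist q z) (fun s => by rw [zero_add, hv, hχ.dist_eq, dist_add_right]) 0
  simpa using this

/-- An automorphism that translates an apartment in a regular direction is strongly regular. -/
lemma IsCAT0.isStronglyRegularHyperbolic_of_translation [ProperSpace X] (hX : IsCAT0 X)
    {Δ : EuclideanBuilding X} {h : X ≃ᵢ X} (hh : Δ.IsAutomorphism h)
    {ψ : EuclideanSpace ℝ (Fin Δ.dim) → X} (hψ : ψ ∈ Δ.charts)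
    {u : EuclideanSpace ℝ (Fin Δ.dim)} (hu : IsRegularDirection Δ.W u) (hu1 : ‖u‖ = 1) {l : ℝ}
    (hl0 : 0 < l) (hl : ∀ y, h (ψ y) = ψ (y + l • u)) : Δ.IsStronglyRegularHyperbolic h := by
  have hC := Δ.complete.prop
  have hψi := hC.isometry ψ hψ
  set c : ℝ → X := fun s => ψ (0 + s • u) with hc
  have hci : Isometry c := Isometry.of_dist_eq fun s s' => by
    rw [hc, hψi.dist_eq, dist_eq_norm, add_sub_add_left_eq_sub, ← sub_smul, norm_smul, hu1,
      mul_one, Real.dist_eq, Real.norm_eq_abs]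
  have hch : ∀ s, h (c s) = c (s + l) := fun s => by
    simp only [hc]
    rw [hl]
    congr 1
    module
  have htl := translationLength_eq_of_line hci hl0 hch
  have hmin : minSet h = range ψ := by
    apply Subset.antisymm
    · intro y hy
      obtain ⟨c', hc', rfl, hch'⟩ := hX.exists_line_of_mem_minSet (by rwa [htl]) hy
      rw [htl] at hch'
      -- The axes `c` and `c'` are translated by the same amount, so their distance is periodic,
      -- hence bounded.
      have hper : Function.Periodic (fun s => dist (c s) (c' s)) l := fun s => by
        simp only
        rw [← hch, ← hch', h.isometry.dist_eq]
      refine hX.mem_range_of_parallel Δ.reflectionGroup hC hψ (p := 0) hu hu1 hc'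
        (K := l + dist (c 0) (c' 0) + l) (fun s => ?_) 0
      obtain ⟨r, hr, hsr⟩ := hper.exists_mem_Ico₀ hl0 s
      refine hsr.trans_le ?_
      refine (dist_triangle4 (c r) (c 0) (c' 0) (c' r)).trans ?_
      rw [hci.dist_eq, hc'.dist_eq, dist_comm 0 r, Real.dist_eq, sub_zero, abs_of_nonneg hr.1]
      linarith [hr.2]
    · rintro _ ⟨y, rfl⟩
      rw [minSet, mem_ofPred_eq, htl, hl, hψi.dist_eq, dist_eq_norm, sub_add_cancel_left, norm_neg,
        norm_smul, hu1, mul_one, Real.norm_of_nonneg hl0.le]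
  refine ⟨hh, ⟨isHyperbolic_of_line hci hl0 hch, range ψ, hX.isMaximalFlat_range hψ hu hu1, ?_⟩,
    range ψ, ⟨ψ, hψ, rfl⟩, hmin.ge, ?_, ⟨_, isTranslationAxis_of_line hci hl0 hch⟩, ?_⟩
  · rw [hmin, hausdorffEDist_self]
    exact ENNReal.zero_lt_top
  · rintro _ ⟨χ, hχ, rfl⟩ hsub
    obtain ⟨w, hw, hag⟩ := hC.exists_iso χ hχ ψ hψ
    rw [hmin] at hsub
    have : χ = fun x => ψ (w x) := funext fun x => hag x (hsub (mem_range_self x))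
    rw [this]
    exact w.surjective.range_comp ψ
  · rintro L ⟨c', hc', rfl, hch'⟩ χ hχ hrange v b hv
    rw [htl] at hch'
    obtain ⟨w, hw, hag⟩ := hC.exists_iso ψ hψ χ hχ
    have hag' : ∀ x, ψ x = χ (w x) := fun x => hag x (hrange ▸ mem_range_self x)
    have hcmin : ∀ s, c' s ∈ minSet h := fun s => by
      rw [minSet, mem_ofPred_eq, htl, hch', hc'.dist_eq, Real.dist_eq, sub_add_cancel_left,
        abs_neg, abs_of_pos hl0]
    rw [hmin] at hcmin
    obtain ⟨q, v', hv', hq⟩ := hψi.exists_eq_chart_line hc' hcmin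
    have hvu : v' = u := by
      have h1 := hch' 0
      rw [hq, hq, hl] at h1
      have h2 := hψi.injective h1
      have h3 : l • u = l • v' := by simpa using h2
      exact (smul_right_injective _ hl0.ne' h3).symm
    subst hvu
    have hL : ∀ s : ℝ, χ (w q + s • w.linearIsometryEquiv v') ∈ range c' := fun s =>
      ⟨s, by rw [hq, hag', w.apply_add, map_smul]⟩
    have hne : inner ℝ v (w.linearIsometryEquiv v') ≠ 0 := by
      rw [← w.linearIsometryEquiv.apply_symm_apply v, LinearIsometryEquiv.inner_map_map]
      obtain ⟨b', hb'⟩ := symm_map_mem_wallNormals ⟨b, hv⟩ hw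
      exact hu _ b' hb'
    set t : ℝ := inner ℝ v (w.linearIsometryEquiv v') with ht
    -- The axis is transverse to the wall, so the linear form `inner ℝ v` takes every value on it,
    -- in particular `b - 1` and `b + 1`.
    have hval : ∀ a : ℝ, inner ℝ v (w q + ((a - inner ℝ v (w q)) / t) • w.linearIsometryEquiv v')
        = a := fun a => by
      rw [inner_add_right, inner_smul_right, ← ht, div_mul_cancel₀ _ hne]
      ring
    exact ⟨⟨_, hL ((b - 1 - inner ℝ v (w q)) / t), by rw [hval]; linarith⟩,
      ⟨_, hL ((b + 1 - inner ℝ v (w q)) / t), by rw [hval]; linarith⟩⟩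

end StronglyRegular

/-! ### The theorem. -/

theorem mainTheorem7 {X : Type*} [MetricSpace X] [ProperSpace X] (hX : IsCAT0 X)
    (G : Subgroup (X ≃ᵢ X)) (ρ : ℝ → X) (hρ : Isometry ρ)
    (t : ℕ → ℝ) (ht_pos : ∀ n, 0 < t n) (ht_mono : Monotone t) (ht_top : Tendsto t atTop atTop)
    (ht_gap : BddAbove (range fun n => dist (ρ (t n)) (ρ (t (n + 1)))))
    (h_fin : (range fun n => isometryOrbit G (ρ (t n))).Finite)
    (h_disc : ∀ n, DiscreteTopology (isometryOrbit G (ρ (t n)))) :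
    (∃ f : ℕ → ℕ, StrictMono f ∧ (∀ n, 0 < f n) ∧
      ∀ m n, m < n → ∃ h ∈ G, IsHyperbolic h ∧
        ∃ L, IsTranslationAxis h L ∧ ρ '' Icc (t (f m)) (t (f n)) ⊆ L) ∧
    (∀ Δ : EuclideanBuilding X, Δ.IsLocallyFinite → (∀ g ∈ G, Δ.IsAutomorphism g) →
      Δ.IsStronglyRegularLine ρ hρ →
      ∃ f : ℕ → ℕ, StrictMono f ∧ (∀ n, 0 < f n) ∧
        ∀ m n, m < n → ∃ h ∈ G, IsHyperbolic h ∧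
          (∃ L, IsTranslationAxis h L ∧ ρ '' Icc (t (f m)) (t (f n)) ⊆ L) ∧
          Δ.IsStronglyRegularHyperbolic h) := by
  obtain ⟨f, hf, hf0, hft, hfG⟩ := exists_recurrent_subsequence G ρ t ht_top ht_gap h_fin h_disc
  have hlt : ∀ m n, m < n → t (f m) < t (f n) := fun m n hmn =>
    (hft m).trans_le (ht_mono (hf hmn))
  have hline : ∀ m n, m < n → ∃ h ∈ G, ∃ c : ℝ → X, Isometry c ∧
      (∀ s ∈ Icc (t (f m)) (t (f n)), c s = ρ s) ∧
      ∀ s, h (c s) = c (s + (t (f n) - t (f m))) := by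
    intro m n hmn
    obtain ⟨h, hG, h1, h2⟩ := hfG m n
    obtain ⟨c, hc⟩ := hX.exists_line_of_shift hρ (hlt m n hmn) (hft m) (hft n) h1 h2
    exact ⟨h, hG, c, hc⟩
  have hsub : ∀ {a b : ℝ} {c : ℝ → X}, (∀ s ∈ Icc a b, c s = ρ s) → ρ '' Icc a b ⊆ range c := by
    rintro a b c hcρ _ ⟨s, hs, rfl⟩
    exact ⟨s, hcρ s hs⟩
  refine ⟨⟨f, hf, hf0, fun m n hmn => ?_⟩, fun Δ _ hΔ hreg => ⟨f, hf, hf0, fun m n hmn => ?_⟩⟩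
  · obtain ⟨h, hG, c, hc, hcρ, hch⟩ := hline m n hmn
    have hpos := sub_pos.2 (hlt m n hmn)
    exact ⟨h, hG, isHyperbolic_of_line hc hpos hch, range c, isTranslationAxis_of_line hc hpos hch,
      hsub hcρ⟩
  · obtain ⟨h, hG, c, hc, hcρ, hch⟩ := hline m n hmn
    have hpos := sub_pos.2 (hlt m n hmn)
    obtain ⟨φ, hφ, p, u, hu, hu1, hφρ⟩ := hreg.exists_chart hX
    obtain ⟨ψ, hψ, hψc⟩ := hX.exists_chart_of_line Δ.reflectionGroup Δ.complete hφ hu hc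
      (hlt m n hmn) fun s hs => by rw [hcρ s hs, hφρ]
    -- Replacing `h` by `h ^ k` keeps the axis `c` and multiplies its translation length by `k`, so
    -- the same `f` serves both halves.
    obtain ⟨k, hk, htr⟩ := hX.exists_pow_translation (hΔ h hG) hψ hu hu1
      (l := t (f n) - t (f m)) fun s => by rw [← hψc, hch, hψc]
    have hpos' : 0 < k * (t (f n) - t (f m)) := by positivity
    have hck := pow_apply_line hch k
    exact ⟨h ^ k, G.pow_mem hG k, isHyperbolic_of_line hc hpos' hck,
      ⟨range c, isTranslationAxis_of_line hc hpos' hck, hsub hcρ⟩,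
      hX.isStronglyRegularHyperbolic_of_translation ((hΔ h hG).pow k) hψ hu hu1 hpos' htr⟩
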